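/- Throughout, let $G$ be an abelian group and $n\ge 3$. A $G$-$n$-tuple is $\vec d=(d_1,\dots,d_n)\in G^n$ with $\sum_i d_i=0$; put $\vec d(I)=\sum_{i\in I}d_i$ for $I\subset[n]=\{1,\dots,n\}$. A function $f\colon G\to\mathbb{Q}$ is symmetric if $f(-a)=f(a)$ for all $a$, and a symmetric $f$ is F-nef if $f(a)+f(b)+f(c)+f(a+b+c)\ge f(a+b)+f(a+c)+f(b+c)$ for all $a,b,c\in G$. A weighting is a function $w$ from the edges $i\sim j$ of the complete graph on $[n]$ to $\mathbb{Q}$; put $w(i)=\sum_{j\ne i}w(i\sim j)$ and, for a partition $I\sqcup J=[n]$ into two non-empty parts, $w(I\mid J)=\sum_{i\in I,\,j\in J}w(i\sim j)$. The partition is proper if $|I|,|J|\ge 2$. For a symmetric $f$ and a $G$-$n$-tuple $\vec d$, consider the conditions on $w$: (a) $w(i)=f(d_i)$ for all $i$; (b) $w(I\mid J)\ge f(\vec d(I))$ for all proper partitions $I\sqcup J=[n]$. - $f$ is effective with respect to $\vec d$ if some weighting satisfies (a) and (b). - An $[n]$-labeled tree is a finite tree whose leaves are labeled bijectively by $[n]$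 and all of whose other nodes have valence at least $3$; its $T$-partitions are the partitions $I\sqcup J=[n]$ of the leaves obtained by deleting one edge (edges at leaves included). For such a tree $T$, $f$ is $T$-effective with respect to $\vec d$ if some weighting satisfies (a), (b) and $w(I\mid J)=f(\vec d(I))$ for all $T$-partitions $I\sqcup J$. - $f$ is cyclically effective with respect to $\vec d$ if for every bijection $\sigma$ from $[n]$ to the vertices of a regular $n$-gon some weighting satisfies (a), (b) and $w(I\mid J)=f(\vec d(I))$ for all partitions $I\sqcup J=[n]$ such that $\sigma(I)$ is a set of contiguous vertices. A symmetric $f$ is effective (respectively, cyclically effective) if it is so with respect to every $G$-$n$-tuple for every $n\ge3$. Proposition. Let $m\ge 3$ and let $f\colon\mathbb{Z}_m\to\mathbb{Q}$ be a symmetric function with $f(0)=0$ that is cyclically effective and F-nef. Put \[ m(f)=\tfrac12\min\{2f(a)+2f(b)-f(a+b)-f(a-b)\mid a,b\in\mathbb{Z}_m\setminus\{0\}\}, \] let $\widetilde f(0)=m(f)$ and $\widetilde f(k)=f(k)$ for $k\ne0$, and let \[ Q_f(x_0,\dots,x_{m-1})=\sum_{0\le i,j\le m-1}q_f(i-j)\,x_ix_j,\qquad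 q_f(a)=\tfrac12\bigl(f(a+1)+f(a-1)-2f(a)\bigr). \] Suppose that $Q_f(x)\ge m(f)$ for every non-zero $x\in\mathbb{Z}^m$ with $\sum_i x_i=0$. Then $\widetilde f$ is effective. Moreover, for every $n\ge3$, every $\mathbb{Z}_m$-$n$-tuple $\vec d$ and every $[n]$-labeled tree $T$ all of whose $T$-partitions $I\sqcup J=[n]$ satisfy $\vec d(I)\ne0$ in $\mathbb{Z}_m$, the function $\widetilde f$ is $T$-effective with respect to $\vec d$. -/

import Mathlib

namespace M0n

/-! ### Symmetric and F-nef functions on an abelian group -/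

/-- A function on an abelian group is symmetric if `f (-a) = f a`. -/
def IsSymm {G : Type*} [AddCommGroup G] (f : G → ℚ) : Prop :=
  ∀ a, f (-a) = f a

/-- F-nef functions. -/
def IsFNef {G : Type*} [AddCommGroup G] (f : G → ℚ) : Prop :=
  IsSymm f ∧ ∀ a b c, f (a + b) + f (a + c) + f (b + c) ≤ f a + f b + f c + f (a + b + c)

/-! ### Weightings of the complete graph on `[n]` -/

/-- A weighting of the complete graph on `Fin n`; the weight of the edge `i ∼ j` is `w s(i, j)`.
The values on the diagonal of `Sym2 (Fin n)` are never used. -/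
abbrev Weighting (n : ℕ) := Sym2 (Fin n) → ℚ

/-- The flow through a vertex. -/
def vertexFlow {n : ℕ} (w : Weighting n) (k : Fin n) : ℚ :=
  ∑ i ∈ Finset.univ.erase k, w s(k, i)

/-- The flow across the partition `I ⊔ Iᶜ` of `[n]`. -/
def flow {n : ℕ} (w : Weighting n) (I : Finset (Fin n)) : ℚ :=
  ∑ i ∈ I, ∑ j ∈ Iᶜ, w s(i, j)

/-- The partition `I ⊔ Iᶜ` of `[n]` is proper: both parts have at least two elements. -/
def IsProper {n : ℕ} (I : Finset (Fin n)) : Prop :=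
  2 ≤ I.card ∧ 2 ≤ Iᶜ.card

/-- Conditions (a), (b) common to all notions of effectivity of `f` with respect to `d`: the flow
through each vertex `i` is `f (d i)`, the flow across each proper partition `I ⊔ J` is at
least `f (d(I))`, where `d(I) = ∑ i ∈ I, d i`. -/
def IsAdmissible {G : Type*} [AddCommGroup G] (f : G → ℚ) {n : ℕ} (d : Fin n → G)
    (w : Weighting n) : Prop :=
  (∀ i, vertexFlow w i = f (d i)) ∧ ∀ I, IsProper I → f (∑ i ∈ I, d i) ≤ flow w I

/-! ### Effectivity -/

/-- `f` is effective with respect to `d`. -/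
def EffectiveWrt {G : Type*} [AddCommGroup G] (f : G → ℚ) {n : ℕ} (d : Fin n → G) : Prop :=
  ∃ w : Weighting n, IsAdmissible f d w

/-- `f` is effective: for all `n ≥ 3`, it is effective with respect to every `n`-tuple `d` of
elements of `G` with sum zero. -/
def IsEffective {G : Type*} [AddCommGroup G] (f : G → ℚ) : Prop :=
  IsSymm f ∧ ∀ n : ℕ, 3 ≤ n → ∀ d : Fin n → G, ∑ i, d i = 0 → EffectiveWrt f d

/-- For a cyclic ordering of `[n]`, represented by a bijection `σ` with the vertices `ZMod n` of the
regular `n`-gon: the partition `I ⊔ Iᶜ` (with non-empty parts) is `σ`-contiguous if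
`σ(I) = {s, s + 1, …, s + k - 1}` for some `s` and `k`.
This is unchanged when `σ` is composed with a rotation. -/
def IsContiguous {n : ℕ} (σ : Fin n ≃ ZMod n) (I : Finset (Fin n)) : Prop :=
  I.Nonempty ∧ Iᶜ.Nonempty ∧
    ∃ (s : ZMod n) (k : ℕ), ∀ i, i ∈ I ↔ ∃ j : ℕ, j < k ∧ σ i = s + (j : ZMod n)

/-- `f` is cyclically effective with respect to `d`. -/
def CyclicallyEffectiveWrt {G : Type*} [AddCommGroup G] (f : G → ℚ) {n : ℕ} (d : Fin n → G) :
    Prop :=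
  ∀ σ : Fin n ≃ ZMod n, ∃ w : Weighting n, IsAdmissible f d w ∧
    ∀ I, IsContiguous σ I → flow w I = f (∑ i ∈ I, d i)

/-- `f` is cyclically effective. -/
def IsCyclicallyEffective {G : Type*} [AddCommGroup G] (f : G → ℚ) : Prop :=
  IsSymm f ∧ ∀ n : ℕ, 3 ≤ n → ∀ d : Fin n → G, ∑ i, d i = 0 → CyclicallyEffectiveWrt f d

/-- `T` with the labelling `leaf` is an `[n]`-labeled tree: a finite tree whose leaves (the
vertices of valence one) are labeled bijectively by `[n]`, and all of whose other vertices have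
valence at least three. -/
structure IsLabeledTree {V : Type*} {n : ℕ} (T : SimpleGraph V) (leaf : Fin n → V) : Prop where
  finite : Finite V
  isTree : T.IsTree
  leaf_injective : Function.Injective leaf
  leaf_iff : ∀ v, (T.neighborSet v).ncard = 1 ↔ v ∈ Set.range leaf
  internal : ∀ v, v ∉ Set.range leaf → 3 ≤ (T.neighborSet v).ncard

/-- `I ⊔ Iᶜ` is a `T`-partition: for some edge `u ∼ v` of `T`, `I` is the set of (labels of)
leaves in the component of `u` after deletion of that edge. -/
def IsTreePartition {V : Type*} {n : ℕ} (T : SimpleGraph V) (leaf : Fin n → V)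
    (I : Finset (Fin n)) : Prop :=
  ∃ u v, T.Adj u v ∧ ∀ i, i ∈ I ↔ (T.deleteEdges {s(u, v)}).Reachable u (leaf i)

/-- `f` is `T`-effective with respect to `d`. -/
def TreeEffectiveWrt {V : Type*} {n : ℕ} (T : SimpleGraph V) (leaf : Fin n → V)
    {G : Type*} [AddCommGroup G] (f : G → ℚ) (d : Fin n → G) : Prop :=
  ∃ w : Weighting n, IsAdmissible f d w ∧
    ∀ I, IsTreePartition T leaf I → flow w I = f (∑ i ∈ I, d i)

/-! ### The modified function and the quadratic form -/

/-- `m(f)`: half of the minimum of `2 f(a) + 2 f(b) - f(a + b) - f(a - b)` over non-zero `a, b`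
(and `0` by convention for the trivial group, where there are no such pairs). -/
def minVal {G : Type*} [AddCommGroup G] [Fintype G] [DecidableEq G] (f : G → ℚ) : ℚ :=
  if h : (Finset.univ.filter fun p : G × G => p.1 ≠ 0 ∧ p.2 ≠ 0).Nonempty then
    (1 / 2) * (Finset.univ.filter fun p : G × G => p.1 ≠ 0 ∧ p.2 ≠ 0).inf' h
      fun p => 2 * f p.1 + 2 * f p.2 - f (p.1 + p.2) - f (p.1 - p.2)
  else 0

theorem isLeast_minVal {G : Type*} [AddCommGroup G] [Fintype G] [DecidableEq G] [Nontrivial G]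
    (f : G → ℚ) :
    IsLeast {x : ℚ | ∃ a b : G, a ≠ 0 ∧ b ≠ 0 ∧
      x = (1 / 2) * (2 * f a + 2 * f b - f (a + b) - f (a - b))} (minVal f) := by
  obtain ⟨g, hg⟩ := exists_ne (0 : G)
  have h : (Finset.univ.filter fun p : G × G => p.1 ≠ 0 ∧ p.2 ≠ 0).Nonempty :=
    ⟨(g, g), by simp [hg]⟩
  rw [minVal, dif_pos h]
  constructor
  · obtain ⟨p, hp, he⟩ := Finset.exists_mem_eq_inf' h
      (fun p : G × G => 2 * f p.1 + 2 * f p.2 - f (p.1 + p.2) - f (p.1 - p.2))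
    rw [Finset.mem_filter] at hp
    exact ⟨p.1, p.2, hp.2.1, hp.2.2, by rw [he]⟩
  · rintro x ⟨a, b, ha, hb, rfl⟩
    have := Finset.inf'_le
      (fun p : G × G => 2 * f p.1 + 2 * f p.2 - f (p.1 + p.2) - f (p.1 - p.2))
      (show (a, b) ∈ Finset.univ.filter fun p : G × G => p.1 ≠ 0 ∧ p.2 ≠ 0 by simp [ha, hb])
    exact mul_le_mul_of_nonneg_left this (by norm_num)

/-- The function that agrees with `f` away from `0` and has value `m(f)` at `0`. -/
def tilde {G : Type*} [AddCommGroup G] [Fintype G] [DecidableEq G] (f : G → ℚ) : G → ℚ :=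
  fun k => if k = 0 then minVal f else f k

/-- `q_f(a) = (f(a + 1) + f(a - 1) - 2 f(a)) / 2`. -/
def secondDiff {m : ℕ} (f : ZMod m → ℚ) (a : ZMod m) : ℚ :=
  (1 / 2) * (f (a + 1) + f (a - 1) - 2 * f a)

/-- The quadratic form `Q_f(x) = ∑ q_f(i - j) x_i x_j` associated to `f`, with the variables
`x_0, …, x_{m-1}` indexed by `ZMod m`. -/
def quadForm {m : ℕ} [NeZero m] (f : ZMod m → ℚ) (x : ZMod m → ℚ) : ℚ :=
  ∑ i, ∑ j, secondDiff f (i - j) * x i * x j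

end M0n

/-!
For `y : G → ℤ` with entries summing to zero, the energy `-½ ∑ f (u - v) y_u y_v` depends only on
the second differences of `f`; on `ZMod m` the vectors with `∑ y_u = 0` and `∑ y_u • u = 0` are
exactly the second differences of vectors with sum zero, and their energy is the value of `Q_f`
there. The hypothesis thus says that a nonzero such `y` has energy at least `m(f)`, which makes
sense on every finite abelian group.

A cyclic ordering of the labels walks through `G` by the steps `d i`. A weighting that realizes the
cyclic effectivity of `f` for this ordering is determined by its flows across contiguous sets, and
its flow across `I` is the energy of the sum of the arcs of the walk with labels in `I`. If
`d(I) = 0`, this flow is therefore at least `m(f)`, unless that sum of arcs vanishes. As `f` and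
`tilde f` differ only at zero, this exception is the only obstacle when no `d i` is zero.

It is overcome by averaging over several orderings. Swapping two adjacent blocks with sums `a` and
`b`, one of them inside `I` and the other outside, changes the sum of arcs by the boundary of a
parallelogram with sides `a` and `b`, whose energy `2 f a + 2 f b - f (a + b) - f (a - b)` is at
least `2 m(f)` if `a` and `b` are nonzero. So if the sum of arcs vanishes for one ordering, the
energy for the other compensates. The blocks come from a tree: a laminar family of sets with nonzero
sums is contained in a maximal one, and maximality forces every member to split into two members, or
into three that share the same sum of order two. In the second case the three rotations of the
blocks are averaged instead. The blocks of the tree are contiguous in all these orderings, so the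
flows across them are as prescribed; applied to the partitions of a labeled tree this gives
tree-effectivity. Labels that are zero are inserted one at a time, by subdividing an edge.
-/

namespace M0n

/-! ### The energy of an integral vector -/

section Energy

variable {G : Type*} [AddCommGroup G] [DecidableEq G]

/-- The integral vector `[p + a] - [p]`, the boundary of the arc from `p` to `p + a`. -/
def arc (p a : G) : G → ℤ := Pi.single (p + a) 1 - Pi.single p 1

theorem arc_zero (p : G) : arc p 0 = 0 := by simp [arc]

theorem arc_add (p a b : G) : arc p (a + b) = arc p a + arc (p + a) b := by
  simp [arc, add_assoc]

theorem arc_add_neg (p a : G) : arc (p + a) (-a) = -arc p a := by simp [arc]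

variable [Fintype G]

theorem sum_arc (p a : G) : ∑ u, arc p a u = 0 := by simp [arc, Finset.sum_sub_distrib]

theorem sum_arc_smul (p a : G) : ∑ u, arc p a u • u = a := by
  simp [arc, sub_smul, Finset.sum_sub_distrib, Pi.single_apply, ite_smul]

theorem eq_sum_smul_arc {y : G → ℤ} (hy : ∑ u, y u = 0) : y = ∑ u, y u • arc 0 u := by
  ext v
  simp [arc, Finset.sum_apply, mul_sub, Finset.sum_sub_distrib, Pi.single_apply, hy]

/-- The bilinear form on integral vectors with Gram matrix `-f (u - v) / 2`. On vectors with
entries summing to zero it depends on `f` only through its second differences. -/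
def energyForm (f : G → ℚ) : (G → ℤ) →ₗ[ℤ] (G → ℤ) →ₗ[ℤ] ℚ :=
  Matrix.toLinearMap₂' ℤ (Matrix.of fun u v => -f (u - v) / 2)

/-- The quadratic form `y ↦ -½ ∑ f (u - v) y_u y_v` of `energyForm f`, normalized so that an arc
from `p` to `p + a` has energy `f a`. -/
def energy (f : G → ℚ) : QuadraticMap ℤ (G → ℤ) ℚ :=
  LinearMap.BilinMap.toQuadraticMap (energyForm f)

theorem energy_apply (f : G → ℚ) (y : G → ℤ) : energy f y = energyForm f y y := rfl

theorem energyForm_comm {f : G → ℚ} (hf : IsSymm f) (x y : G → ℤ) :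
    energyForm f x y = energyForm f y x := by
  simp only [energyForm, Matrix.toLinearMap₂'_apply, Matrix.of_apply]
  rw [Finset.sum_comm]
  refine Finset.sum_congr rfl fun u _ => Finset.sum_congr rfl fun v _ => ?_
  rw [← neg_sub u v, hf, smul_comm]

theorem energyForm_single (f : G → ℚ) (u v : G) :
    energyForm f (Pi.single u 1) (Pi.single v 1) = -f (u - v) / 2 := by
  simp [energyForm, Matrix.toLinearMap₂'_apply, Pi.single_apply, ite_smul]

theorem energyForm_arc (f : G → ℚ) (p a q b : G) :
    energyForm f (arc p a) (arc q b) =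
      1 / 2 * (f (p - q + a) + f (p - q - b) - f (p - q) - f (p - q + a - b)) := by
  simp only [arc, map_sub, LinearMap.sub_apply, energyForm_single]
  rw [show p + a - (q + b) = p - q + a - b by abel, show p - (q + b) = p - q - b by abel,
    show p + a - q = p - q + a by abel]
  ring

variable {f : G → ℚ}

theorem energy_arc (hf : IsSymm f) (hf0 : f 0 = 0) (p a : G) : energy f (arc p a) = f a := by
  rw [energy_apply, energyForm_arc, sub_self, zero_add, zero_sub, sub_self, hf, hf0]
  ring

theorem energy_sub (hf : IsSymm f) (x y : G → ℤ) :
    energy f (x - y) = energy f x + energy f y - 2 * energyForm f x y := by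
  simp only [energy_apply, map_sub, LinearMap.sub_apply, energyForm_comm hf y x]
  ring

theorem energy_arc_sub_arc (hf : IsSymm f) (hf0 : f 0 = 0) (p a b : G) :
    energy f (arc p a - arc (p + b) a) = 2 * f a + 2 * f b - f (a + b) - f (a - b) := by
  rw [energy_sub hf, energy_arc hf hf0, energy_arc hf hf0, energyForm_arc,
    show p - (p + b) = -b by abel, show -b + a = a - b by abel, show -b - a = -(a + b) by abel,
    show a - b - a = -b by abel, hf, hf]
  ring

end Energy

section QuadForm

variable {m : ℕ} [NeZero m] {f : ZMod m → ℚ}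

theorem secondDiff_sub_eq_energyForm (f : ZMod m → ℚ) (u v : ZMod m) :
    secondDiff f (u - v) = energyForm f (arc u 1) (arc v 1) := by
  rw [energyForm_arc, add_sub_cancel_right, secondDiff]
  ring

theorem quadForm_eq_energy (f : ZMod m → ℚ) (x : ZMod m → ℤ) :
    quadForm f (fun i => (x i : ℚ)) = energy f (∑ u, x u • arc u 1) := by
  simp only [quadForm, energy_apply, map_sum, LinearMap.sum_apply, map_smul, LinearMap.smul_apply,
    secondDiff_sub_eq_energyForm, Finset.smul_sum]
  rw [Finset.sum_comm]
  refine Finset.sum_congr rfl fun u _ => Finset.sum_congr rfl fun v _ => ?_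
  rw [zsmul_eq_mul, zsmul_eq_mul]
  ring

theorem arc_mem_span_unit_arcs (p a : ZMod m) :
    arc p a ∈ Submodule.span ℤ (Set.range fun u : ZMod m => arc u 1) := by
  obtain ⟨k, rfl⟩ := ZMod.natCast_zmod_surjective a
  induction k with
  | zero => simp [arc_zero]
  | succ k ih =>
    rw [Nat.cast_succ, arc_add]
    exact add_mem ih (Submodule.subset_span ⟨_, rfl⟩)

theorem sum_unit_arcs : ∑ u : ZMod m, arc u 1 = 0 := by
  simp only [arc, Finset.sum_sub_distrib]
  exact sub_eq_zero.2 (Equiv.sum_comp (Equiv.addRight 1) fun u => Pi.single u 1)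

theorem exists_eq_sum_smul_unit_arcs {y : ZMod m → ℤ} (hy : ∑ u, y u = 0)
    (hy' : ∑ u, y u • u = 0) :
    ∃ x : ZMod m → ℤ, ∑ u, x u = 0 ∧ y = ∑ u, x u • arc u 1 := by
  have hmem : y ∈ Submodule.span ℤ (Set.range fun u : ZMod m => arc u 1) := by
    rw [eq_sum_smul_arc hy]
    exact sum_mem fun u _ => Submodule.smul_mem _ _ (arc_mem_span_unit_arcs 0 u)
  obtain ⟨x, rfl⟩ := (Submodule.mem_span_range_iff_exists_fun ℤ).1 hmem
  have hmoment : ((∑ u, x u : ℤ) : ZMod m) = 0 := by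
    rw [← hy']
    simp only [Finset.sum_apply, Pi.smul_apply, Finset.sum_smul, smul_assoc]
    rw [Finset.sum_comm]
    simp only [← Finset.smul_sum, sum_arc_smul, Int.cast_sum, zsmul_one]
  obtain ⟨c, hc⟩ := (ZMod.intCast_zmod_eq_zero_iff_dvd _ m).1 hmoment
  -- The unit arcs sum to zero, so the mass of `x` may be changed by any multiple of `m`.
  refine ⟨fun u => x u - c, ?_, ?_⟩
  · simp [Finset.sum_sub_distrib, hc, ZMod.card]
  · simp only [sub_smul, Finset.sum_sub_distrib, ← Finset.smul_sum, sum_unit_arcs, smul_zero,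
      sub_zero]

theorem le_energy_of_le_quadForm {c : ℚ}
    (hQ : ∀ x : ZMod m → ℤ, x ≠ 0 → ∑ i, x i = 0 → c ≤ quadForm f (fun i => (x i : ℚ)))
    {y : ZMod m → ℤ} (hy : y ≠ 0) (hy0 : ∑ u, y u = 0) (hy1 : ∑ u, y u • u = 0) :
    c ≤ energy f y := by
  obtain ⟨x, hx, rfl⟩ := exists_eq_sum_smul_unit_arcs hy0 hy1
  rw [← quadForm_eq_energy]
  exact hQ x (fun h => hy (by simp [h])) hx

end QuadForm

section MinVal

variable {G : Type*} [AddCommGroup G] [Fintype G] [DecidableEq G] {f : G → ℚ}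

theorem two_mul_minVal_le (f : G → ℚ) {a b : G} (ha : a ≠ 0) (hb : b ≠ 0) :
    2 * minVal f ≤ 2 * f a + 2 * f b - f (a + b) - f (a - b) := by
  have := nontrivial_of_ne a 0 ha
  linarith [(isLeast_minVal f).2 ⟨a, b, ha, hb, rfl⟩]

theorem minVal_nonneg (hf : IsSymm f) (hf0 : f 0 = 0)
    (hE : ∀ y : G → ℤ, y ≠ 0 → ∑ u, y u = 0 → ∑ u, y u • u = 0 → minVal f ≤ energy f y) :
    0 ≤ minVal f := by
  rcases subsingleton_or_nontrivial G with hG | hG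
  · rw [minVal, dif_neg]
    rintro ⟨p, hp⟩
    exact (Finset.mem_filter.1 hp).2.1 (Subsingleton.elim _ _)
  obtain ⟨a, b, -, -, hab⟩ := (isLeast_minVal f).1
  rw [← energy_arc_sub_arc hf hf0 0] at hab
  by_cases hy : arc 0 a - arc (0 + b) a = 0
  · rw [hab, hy, QuadraticMap.map_zero, mul_zero]
  · have := hE _ hy (by simp [Finset.sum_sub_distrib, sum_arc])
      (by simp [sub_smul, Finset.sum_sub_distrib, sum_arc_smul])
    linarith

theorem minVal_le_of_add_self_eq_zero (hG : 3 ≤ Fintype.card G) {h : G}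
    (hh : h ≠ 0) (hh2 : h + h = 0) : minVal f ≤ f h := by
  obtain ⟨b, hb, hbh⟩ : ∃ b : G, b ≠ 0 ∧ b ≠ h :=
    ENat.exists_ne_ne_of_three_le (by rw [ENat.card_eq_coe_fintype_card]; exact_mod_cast hG) 0 h
  have hsub : f (b - h) = f (b + h) := by rw [sub_eq_add_neg, neg_eq_of_add_eq_zero_left hh2]
  have hbh' : b + h ≠ 0 := fun e => hbh (add_right_cancel (e.trans hh2.symm))
  have key₁ := two_mul_minVal_le f hb hh
  have key₂ := two_mul_minVal_le f hbh' hh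
  have e₁ : f (b + h + h) = f b := by rw [add_assoc, hh2, add_zero]
  rw [add_sub_cancel_right, e₁] at key₂
  linarith

theorem tilde_zero (f : G → ℚ) : tilde f 0 = minVal f := if_pos rfl

theorem tilde_of_ne (f : G → ℚ) {a : G} (ha : a ≠ 0) : tilde f a = f a := if_neg ha

theorem IsSymm.tilde (hf : IsSymm f) : IsSymm (tilde f) := fun a => by
  simp only [M0n.tilde, neg_eq_zero, hf a]

end MinVal

/-! ### Flows and walks along cyclic orderings -/

section Flow

variable {n : ℕ}

theorem flow_compl (w : Weighting n) (I : Finset (Fin n)) : flow w Iᶜ = flow w I := by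
  unfold flow
  rw [compl_compl, Finset.sum_comm]
  exact Finset.sum_congr rfl fun i _ => Finset.sum_congr rfl fun j _ => by rw [Sym2.eq_swap]

theorem flow_empty (w : Weighting n) : flow w ∅ = 0 := by simp [flow]

theorem flow_univ (w : Weighting n) : flow w Finset.univ = 0 := by simp [flow]

theorem vertexFlow_eq_flow (w : Weighting n) (k : Fin n) : vertexFlow w k = flow w {k} := by
  simp only [vertexFlow, flow, Finset.sum_singleton]
  exact Finset.sum_congr (by ext; simp) fun _ _ => rfl

theorem flow_insert (w : Weighting n) {A : Finset (Fin n)} {i : Fin n} (hi : i ∉ A) :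
    flow w (insert i A) = flow w A + flow w {i} - 2 * ∑ a ∈ A, w s(i, a) := by
  have hA : Aᶜ = insert i (insert i A)ᶜ := by ext x; by_cases hx : x = i <;> simp [hx, hi]
  have hi' : ({i}ᶜ : Finset (Fin n)) = A ∪ (insert i A)ᶜ := by
    ext x; by_cases hx : x = i <;> simp [hx, hi, em]
  have hdisj : Disjoint A (insert i A)ᶜ :=
    disjoint_compl_right.mono_right (Finset.compl_subset_compl.2 (Finset.subset_insert i A))
  have hswap : ∑ a ∈ A, w s(a, i) = ∑ a ∈ A, w s(i, a) :=
    Finset.sum_congr rfl fun a _ => by rw [Sym2.eq_swap]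
  simp only [flow, hA, hi', Finset.sum_insert hi, Finset.sum_singleton, Finset.sum_union hdisj,
    Finset.sum_insert (show i ∉ (insert i A)ᶜ by simp), Finset.sum_add_distrib, hswap]
  ring

theorem two_mul_weight (w : Weighting n) {A : Finset (Fin n)} {i j : Fin n} (hi : i ∉ A)
    (hj : j ∉ A) (hij : i ≠ j) :
    2 * w s(i, j) = flow w (insert i A) + flow w (insert j A) - flow w (insert i (insert j A))
      - flow w A := by
  rw [flow_insert w (show i ∉ insert j A by simp [hij, hi]), flow_insert w hi,
    Finset.sum_insert hj]
  ring

end Flow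

section ArcSum

variable {G ι : Type*} [AddCommGroup G] [DecidableEq G] [DecidableEq ι]

/-- The steps `d i`, for `i` in a list, make up a path of arcs in `G` that starts at `p`. This is
the sum of those arcs of the path whose label lies in `I`. -/
def arcSum (d : ι → G) (I : Finset ι) : G → List ι → G → ℤ
  | _, [] => 0
  | p, i :: l => (if i ∈ I then arc p (d i) else 0) + arcSum d I (p + d i) l

theorem arcSum_append (d : ι → G) (I : Finset ι) (p : G) (l l' : List ι) :
    arcSum d I p (l ++ l') = arcSum d I p l + arcSum d I (p + (l.map d).sum) l' := by
  induction l generalizing p with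
  | nil => simp [arcSum]
  | cons i l ih => simp [arcSum, ih, add_assoc]

theorem arcSum_of_forall_notMem (d : ι → G) {I : Finset ι} (p : G) {l : List ι}
    (h : ∀ i ∈ l, i ∉ I) : arcSum d I p l = 0 := by
  induction l generalizing p with
  | nil => rfl
  | cons i l ih =>
    obtain ⟨hi, hl⟩ := List.forall_mem_cons.1 h
    rw [arcSum, if_neg hi, ih _ hl, zero_add]

theorem arcSum_of_forall_mem (d : ι → G) {I : Finset ι} (p : G) {l : List ι}
    (h : ∀ i ∈ l, i ∈ I) : arcSum d I p l = arc p (l.map d).sum := by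
  induction l generalizing p with
  | nil => simp [arcSum, arc_zero]
  | cons i l ih =>
    obtain ⟨hi, hl⟩ := List.forall_mem_cons.1 h
    rw [arcSum, if_pos hi, ih _ hl, List.map_cons, List.sum_cons, arc_add]

theorem arcSum_eq_sum (d : ι → G) (I : Finset ι) (p : G) (l : List ι) :
    arcSum d I p l = ∑ i ∈ I, arcSum d {i} p l := by
  induction l generalizing p with
  | nil => simp [arcSum]
  | cons i l ih => simp [arcSum, ih (p + d i), Finset.sum_add_distrib]

theorem arcSum_singleton (d : ι → G) (p : G) {i : ι} {l₁ l₂ : List ι} (h₁ : i ∉ l₁)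
    (h₂ : i ∉ l₂) : arcSum d {i} p (l₁ ++ i :: l₂) = arc (p + (l₁.map d).sum) (d i) := by
  have h (l : List ι) (hl : i ∉ l) : ∀ j ∈ l, j ∉ ({i} : Finset ι) := fun j hj e =>
    hl (Finset.mem_singleton.1 e ▸ hj)
  rw [arcSum_append, arcSum_of_forall_notMem d p (h l₁ h₁), arcSum,
    if_pos (Finset.mem_singleton_self i), arcSum_of_forall_notMem d _ (h l₂ h₂), zero_add, add_zero]

variable [Fintype G]

theorem sum_arcSum (d : ι → G) (I : Finset ι) (p : G) (l : List ι) :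
    ∑ u, arcSum d I p l u = 0 := by
  induction l generalizing p with
  | nil => simp [arcSum]
  | cons i l ih =>
    simp only [arcSum, Pi.add_apply, Finset.sum_add_distrib, ih, add_zero]
    split_ifs <;> simp [sum_arc]

theorem sum_arcSum_smul (d : ι → G) (I : Finset ι) (p : G) (l : List ι) :
    ∑ u, arcSum d I p l u • u = (l.map fun i => if i ∈ I then d i else 0).sum := by
  induction l generalizing p with
  | nil => simp [arcSum]
  | cons i l ih =>
    simp only [arcSum, Pi.add_apply, add_smul, Finset.sum_add_distrib, ih, List.map_cons,
      List.sum_cons]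
    split_ifs <;> simp [sum_arc_smul]

theorem sum_arcSum_smul_of_coe_eq_univ [Fintype ι] (d : ι → G) (I : Finset ι) (p : G) {l : List ι}
    (hl : (l : Multiset ι) = Finset.univ.val) : ∑ u, arcSum d I p l u • u = ∑ i ∈ I, d i := by
  rw [sum_arcSum_smul, ← Multiset.sum_coe, ← Multiset.map_coe, hl]
  simp

end ArcSum

section Adapted

variable {G : Type*} [AddCommGroup G] {n : ℕ} {f : G → ℚ} {d : Fin n → G} {w : Weighting n}
  {l : List (Fin n)}

/-- The flow of `w` out of each contiguous segment of the list `l` has the value prescribed by `f`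
and `d`. -/
def IsAdapted (f : G → ℚ) (d : Fin n → G) (w : Weighting n) (l : List (Fin n)) : Prop :=
  ∀ s, s <:+: l → flow w s.toFinset = f (s.map d).sum

variable [Fintype G] [DecidableEq G]

theorem IsAdapted.weight_append (hf : IsSymm f) {i j : Fin n} {l₁ l₂ l₃ : List (Fin n)}
    (hw : IsAdapted f d w (l₁ ++ i :: (l₂ ++ j :: l₃)))
    (hl : (l₁ ++ i :: (l₂ ++ j :: l₃)).Nodup) :
    w s(i, j) = -energyForm f (arcSum d {i} 0 (l₁ ++ i :: (l₂ ++ j :: l₃)))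
      (arcSum d {j} 0 (l₁ ++ i :: (l₂ ++ j :: l₃))) := by
  have hi : i ∉ l₁ ∧ i ∉ l₂ ++ j :: l₃ ∧ i ∉ l₂ ∧ i ≠ j := by grind
  have hj : j ∉ l₁ ++ i :: l₂ ∧ j ∉ l₂ ∧ j ∉ l₃ := by grind
  have flow_l₂ := hw l₂ ⟨l₁ ++ [i], j :: l₃, by simp⟩
  have flow_il₂ := hw (i :: l₂) ⟨l₁, j :: l₃, by simp⟩
  have flow_l₂j := hw (l₂ ++ [j]) ⟨l₁ ++ [i], l₃, by simp⟩
  have flow_il₂j := hw (i :: (l₂ ++ [j])) ⟨l₁, l₃, by simp⟩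
  have weight := two_mul_weight w (A := l₂.toFinset) (by simpa using hi.2.2.1)
    (by simpa using hj.2.1) hi.2.2.2
  have happend : (l₂ ++ [j]).toFinset = insert j l₂.toFinset := by ext; simp
  simp only [List.toFinset_cons, happend, List.map_cons, List.map_append, List.map_nil,
    List.sum_cons, List.sum_append, List.sum_nil, add_zero] at flow_il₂ flow_l₂j flow_il₂j
  have arc_i := arcSum_singleton d 0 hi.1 hi.2.1
  have arc_j := arcSum_singleton d 0 hj.1 hj.2.2
  simp only [List.append_assoc, List.cons_append, List.map_append, List.map_cons, List.sum_append,
    List.sum_cons, zero_add] at arc_i arc_j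
  rw [arc_i, arc_j, energyForm_arc]
  generalize (l₁.map d).sum = p, (l₂.map d).sum = a at *
  rw [show p - (p + (d i + a)) + d i = -a by abel, show p - (p + (d i + a)) = -(d i + a) by abel,
    show -(d i + a) - d j = -(d i + (a + d j)) by abel, show -a - d j = -(a + d j) by abel,
    hf, hf, hf, hf]
  linarith

theorem IsAdapted.weight_eq (hf : IsSymm f) (hw : IsAdapted f d w l) (hl : l.Nodup) {i j : Fin n}
    (hi : i ∈ l) (hj : j ∈ l) (hij : i ≠ j) :
    w s(i, j) = -energyForm f (arcSum d {i} 0 l) (arcSum d {j} 0 l) := by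
  obtain ⟨l₁, r, rfl⟩ := List.append_of_mem hi
  simp only [List.mem_append, List.mem_cons, hij.symm, false_or] at hj
  rcases hj with hj | hj
  · obtain ⟨l₁, l₂, rfl⟩ := List.append_of_mem hj
    rw [List.append_assoc, List.cons_append] at hw hl ⊢
    rw [Sym2.eq_swap, energyForm_comm hf]
    exact hw.weight_append hf hl
  · obtain ⟨l₂, l₃, rfl⟩ := List.append_of_mem hj
    exact hw.weight_append hf hl

theorem IsAdapted.flow_eq_energy (hf : IsSymm f) (hd : ∑ i, d i = 0) (hw : IsAdapted f d w l)
    (hl : (l : Multiset (Fin n)) = Finset.univ.val) (I : Finset (Fin n)) :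
    flow w I = energy f (arcSum d I 0 l) := by
  have hnodup : l.Nodup := Multiset.coe_nodup.1 (hl ▸ Finset.univ.nodup)
  have hmem (i : Fin n) : i ∈ l := Multiset.mem_coe.1 (hl ▸ Finset.mem_univ_val i)
  have hcompl : arcSum d I 0 l = -arcSum d Iᶜ 0 l := by
    rw [eq_neg_iff_add_eq_zero, arcSum_eq_sum d I, arcSum_eq_sum d Iᶜ, Finset.sum_add_sum_compl,
      ← arcSum_eq_sum, arcSum_of_forall_mem d 0 fun i _ => Finset.mem_univ i, ← Multiset.sum_coe,
      ← Multiset.map_coe, hl]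
    exact (congrArg (arc 0) hd).trans (arc_zero 0)
  calc flow w I = ∑ i ∈ I, ∑ j ∈ Iᶜ, -energyForm f (arcSum d {i} 0 l) (arcSum d {j} 0 l) :=
        Finset.sum_congr rfl fun i hi => Finset.sum_congr rfl fun j hj =>
          hw.weight_eq hf hnodup (hmem i) (hmem j) fun e => Finset.mem_compl.1 hj (e ▸ hi)
    _ = -energyForm f (arcSum d I 0 l) (arcSum d Iᶜ 0 l) := by
        rw [arcSum_eq_sum d I, arcSum_eq_sum d Iᶜ]
        simp only [map_sum, LinearMap.sum_apply, Finset.sum_neg_distrib]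
        rw [Finset.sum_comm]
    _ = energy f (arcSum d I 0 l) := by
        rw [energy_apply, ← map_neg, ← hcompl]

end Adapted

section Cyclic

variable {G : Type*} [AddCommGroup G] {n : ℕ} {f : G → ℚ} {d : Fin n → G} {l : List (Fin n)}

theorem exists_equiv_zmod_of_coe_eq_univ [NeZero n]
    (hl : (l : Multiset (Fin n)) = Finset.univ.val) :
    ∃ σ : Fin n ≃ ZMod n, ∀ (k : ℕ) (hk : k < l.length), σ l[k] = k := by
  have hnodup : l.Nodup := Multiset.coe_nodup.1 (hl ▸ Finset.univ.nodup)
  have hlength : l.length = n := by simpa using congrArg Multiset.card hl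
  have hσ (k : ℕ) (hk : k < l.length) : ((l.idxOf l[k] : ℕ) : ZMod n) = k := by
    rw [hnodup.idxOf_getElem]
  have hsurj : Function.Surjective fun i => ((l.idxOf i : ℕ) : ZMod n) := fun x =>
    ⟨l[x.val]'(hlength.symm ▸ ZMod.val_lt x), (hσ _ _).trans (ZMod.natCast_zmod_val x)⟩
  exact ⟨.ofBijective _ ((Fintype.bijective_iff_surjective_and_card _).2
    ⟨hsurj, by rw [Fintype.card_fin, ZMod.card]⟩), hσ⟩

theorem isContiguous_of_infix {σ : Fin n ≃ ZMod n}
    (hσ : ∀ (k : ℕ) (hk : k < l.length), σ l[k] = k) {s : List (Fin n)} (hs : s <:+: l)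
    (h : s.toFinset.Nonempty) (h' : s.toFinsetᶜ.Nonempty) : IsContiguous σ s.toFinset := by
  obtain ⟨a, b, rfl⟩ := hs
  refine ⟨h, h', a.length, s.length, fun i => ?_⟩
  have hσs (k : ℕ) (hk : k < s.length) : σ s[k] = a.length + k := by
    simpa [List.getElem_append, hk] using hσ (a.length + k) (by simp; lia)
  rw [List.mem_toFinset, List.mem_iff_getElem]
  refine exists_congr fun k => ?_
  rw [← exists_prop]
  exact exists_congr fun hk => by rw [← hσs k hk, σ.apply_eq_iff_eq, eq_comm]

theorem IsCyclicallyEffective.exists_isAdapted (hf : IsCyclicallyEffective f) (hf0 : f 0 = 0)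
    (hn : 3 ≤ n) (hd : ∑ i, d i = 0) (hl : (l : Multiset (Fin n)) = Finset.univ.val) :
    ∃ w : Weighting n, IsAdmissible f d w ∧ IsAdapted f d w l := by
  have : NeZero n := ⟨by lia⟩
  obtain ⟨σ, hσ⟩ := exists_equiv_zmod_of_coe_eq_univ hl
  obtain ⟨w, hw, hflow⟩ := hf.2 n hn d hd σ
  refine ⟨w, hw, fun s hs => ?_⟩
  have hnodup : l.Nodup := Multiset.coe_nodup.1 (hl ▸ Finset.univ.nodup)
  rw [← List.sum_toFinset _ (hnodup.sublist hs.sublist)]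
  rcases s.toFinset.eq_empty_or_nonempty with h | h
  · rw [h, flow_empty, Finset.sum_empty, hf0]
  rcases s.toFinsetᶜ.eq_empty_or_nonempty with h' | h'
  · rw [(Finset.compl_eq_empty_iff _).1 h', flow_univ, hd, hf0]
  exact hflow _ (isContiguous_of_infix hσ hs h h')

end Cyclic

/-! ### Averaging the orderings of a tree -/

/-- Rooted trees with leaves labeled by `ι`, all of whose nodes have two or three children. -/
inductive BinTerTree (ι : Type*) where
  | leaf (i : ι) : BinTerTree ι
  | bin (s t : BinTerTree ι) : BinTerTree ι
  | tri (s t u : BinTerTree ι) : BinTerTree ι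

namespace BinTerTree

variable {ι : Type*}

/-- The labels of the leaves. -/
def leaves : BinTerTree ι → Multiset ι
  | leaf i => {i}
  | bin s t => s.leaves + t.leaves
  | tri s t u => s.leaves + t.leaves + u.leaves

/-- The orderings of the leaves obtained by listing the children of each binary node in both
orders, and those of each ternary node in the three cyclic rotations of the given order. -/
def orders : BinTerTree ι → Multiset (List ι)
  | leaf i => {[i]}
  | bin s t => s.orders.bind fun a => t.orders.bind fun b => {a ++ b, b ++ a}
  | tri s t u => s.orders.bind fun a => t.orders.bind fun b => u.orders.bind fun c =>
      {a ++ b ++ c, b ++ c ++ a, c ++ a ++ b}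

/-- The blocks of the tree: the sets of leaves below a node. -/
def blocks : BinTerTree ι → Set (Multiset ι)
  | leaf i => {{i}}
  | bin s t => insert (s.leaves + t.leaves) (s.blocks ∪ t.blocks)
  | tri s t u => insert (s.leaves + t.leaves + u.leaves) (s.blocks ∪ t.blocks ∪ u.blocks)

/-- The sum of the values of `d` at the leaves. -/
def leafSum {G : Type*} [AddCommGroup G] (d : ι → G) (t : BinTerTree ι) : G := (t.leaves.map d).sum

/-- The children of a binary node have nonzero sums, and those of a ternary node all have as sum
the same element of order two. -/
def IsGood {G : Type*} [AddCommGroup G] (d : ι → G) : BinTerTree ι → Prop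
  | leaf _ => True
  | bin s t => s.IsGood d ∧ t.IsGood d ∧ s.leafSum d ≠ 0 ∧ t.leafSum d ≠ 0
  | tri s t u => s.IsGood d ∧ t.IsGood d ∧ u.IsGood d ∧ s.leafSum d ≠ 0 ∧
      s.leafSum d + s.leafSum d = 0 ∧ t.leafSum d = s.leafSum d ∧ u.leafSum d = s.leafSum d

/-- The set `I` contains some but not all of the leaves. -/
def IsSplitBy (t : BinTerTree ι) (I : Finset ι) : Prop :=
  ∃ i ∈ t.leaves, ∃ j ∈ t.leaves, i ∈ I ∧ j ∉ I

theorem exists_forall_mem_iff_of_not_isSplitBy {t : BinTerTree ι} {I : Finset ι}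
    (ht : ¬t.IsSplitBy I) : ∃ P : Prop, ∀ i ∈ t.leaves, (i ∈ I ↔ P) := by
  simp only [IsSplitBy, not_exists, not_and, not_not] at ht
  exact ⟨∃ i ∈ t.leaves, i ∈ I, fun j hj => ⟨fun h => ⟨j, hj, h⟩, fun ⟨i, hi, h⟩ => ht i hi j hj h⟩⟩

theorem mem_orders_bin {s t : BinTerTree ι} {l : List ι} : l ∈ (bin s t).orders ↔
    ∃ a ∈ s.orders, ∃ b ∈ t.orders, l = a ++ b ∨ l = b ++ a := by
  simp only [orders, Multiset.mem_bind, Multiset.insert_eq_cons, Multiset.mem_cons,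
    Multiset.mem_singleton]

theorem mem_orders_tri {s t u : BinTerTree ι} {l : List ι} : l ∈ (tri s t u).orders ↔
    ∃ a ∈ s.orders, ∃ b ∈ t.orders, ∃ c ∈ u.orders,
      l = a ++ b ++ c ∨ l = b ++ c ++ a ∨ l = c ++ a ++ b := by
  simp only [orders, Multiset.mem_bind, Multiset.insert_eq_cons, Multiset.mem_cons,
    Multiset.mem_singleton]

theorem orders_ne_zero (t : BinTerTree ι) : t.orders ≠ 0 := by
  suffices ∃ l, l ∈ t.orders from fun h => by simp [h] at this
  induction t with
  | leaf i => exact ⟨[i], Multiset.mem_singleton_self _⟩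
  | bin s t hs ht =>
    obtain ⟨⟨a, ha⟩, b, hb⟩ := And.intro hs ht
    exact ⟨a ++ b, mem_orders_bin.2 ⟨a, ha, b, hb, .inl rfl⟩⟩
  | tri s t u hs ht hu =>
    obtain ⟨⟨a, ha⟩, ⟨b, hb⟩, c, hc⟩ := And.intro hs (And.intro ht hu)
    exact ⟨a ++ b ++ c, mem_orders_tri.2 ⟨a, ha, b, hb, c, hc, .inl rfl⟩⟩

theorem coe_of_mem_orders {t : BinTerTree ι} {l : List ι} (h : l ∈ t.orders) :
    (l : Multiset ι) = t.leaves := by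
  induction t generalizing l with
  | leaf i => rw [Multiset.mem_singleton.1 h]; rfl
  | bin s t hs ht =>
    obtain ⟨a, ha, b, hb, rfl | rfl⟩ := mem_orders_bin.1 h <;>
      simp only [leaves, ← hs ha, ← ht hb, ← Multiset.coe_add]
    exact add_comm _ _
  | tri s t u hs ht hu =>
    obtain ⟨a, ha, b, hb, c, hc, rfl | rfl | rfl⟩ := mem_orders_tri.1 h <;>
      simp only [leaves, ← hs ha, ← ht hb, ← hu hc, ← Multiset.coe_add] <;> abel

theorem mem_leaves_of_mem_orders {t : BinTerTree ι} {l : List ι} (h : l ∈ t.orders) {i : ι}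
    (hi : i ∈ l) : i ∈ t.leaves :=
  coe_of_mem_orders h ▸ hi

theorem leafSum_of_mem_orders {G : Type*} [AddCommGroup G] {d : ι → G} {t : BinTerTree ι}
    {l : List ι} (h : l ∈ t.orders) : (l.map d).sum = t.leafSum d := by
  rw [leafSum, ← coe_of_mem_orders h]
  rfl

theorem exists_infix_of_mem_blocks {t : BinTerTree ι} {b : Multiset ι} (hb : b ∈ t.blocks)
    {l : List ι} (hl : l ∈ t.orders) : ∃ r : List ι, r = b ∧ r <:+: l := by
  induction t generalizing l with
  | leaf i => exact ⟨l, (coe_of_mem_orders hl).trans hb.symm, List.infix_rfl⟩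
  | bin s t hs ht =>
    obtain ⟨x, hx, y, hy, hxy⟩ := mem_orders_bin.1 hl
    have hinfix : x <:+: l ∧ y <:+: l := by grind [List.prefix_append, List.suffix_append]
    obtain rfl | hb | hb := hb
    · exact ⟨l, coe_of_mem_orders hl, List.infix_rfl⟩
    · obtain ⟨r, hr, hrx⟩ := hs hb hx
      exact ⟨r, hr, hrx.trans hinfix.1⟩
    · obtain ⟨r, hr, hry⟩ := ht hb hy
      exact ⟨r, hr, hry.trans hinfix.2⟩
  | tri s t u hs ht hu =>
    obtain ⟨x, hx, y, hy, z, hz, hxyz⟩ := mem_orders_tri.1 hl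
    have hinfix : x <:+: l ∧ y <:+: l ∧ z <:+: l := by
      grind [List.prefix_append, List.suffix_append, List.infix_append]
    obtain rfl | (hb | hb) | hb := hb
    · exact ⟨l, coe_of_mem_orders hl, List.infix_rfl⟩
    · obtain ⟨r, hr, hrx⟩ := hs hb hx
      exact ⟨r, hr, hrx.trans hinfix.1⟩
    · obtain ⟨r, hr, hry⟩ := ht hb hy
      exact ⟨r, hr, hry.trans hinfix.2.1⟩
    · obtain ⟨r, hr, hrz⟩ := hu hb hz
      exact ⟨r, hr, hrz.trans hinfix.2.2⟩

theorem orders_bin_comm (s t : BinTerTree ι) : (bin s t).orders = (bin t s).orders := by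
  simp only [orders]
  rw [Multiset.bind_bind]
  exact Multiset.bind_congr fun b _ => Multiset.bind_congr fun a _ => Multiset.pair_comm _ _

theorem orders_tri_rotate (s t u : BinTerTree ι) : (tri s t u).orders = (tri t u s).orders := by
  simp only [orders]
  rw [Multiset.bind_bind]
  refine Multiset.bind_congr fun b _ => ?_
  rw [Multiset.bind_bind]
  refine Multiset.bind_congr fun c _ => Multiset.bind_congr fun a _ => ?_
  simp only [Multiset.insert_eq_cons, ← Multiset.singleton_add]
  abel

theorem sum_map_orders_bin (s t : BinTerTree ι) (F : List ι → ℚ) :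
    ((bin s t).orders.map F).sum =
      (s.orders.map fun a => (t.orders.map fun b => F (a ++ b) + F (b ++ a)).sum).sum := by
  simp [orders, Multiset.map_bind, Multiset.sum_bind]

theorem sum_map_orders_tri (s t u : BinTerTree ι) (F : List ι → ℚ) :
    ((tri s t u).orders.map F).sum =
      (s.orders.map fun a => (t.orders.map fun b => (u.orders.map fun c =>
        F (a ++ b ++ c) + F (b ++ c ++ a) + F (c ++ a ++ b)).sum).sum).sum := by
  simp [orders, Multiset.map_bind, Multiset.sum_bind, add_assoc]

theorem sum_map_nonneg {α : Type*} {s : Multiset α} {F : α → ℚ} (h : ∀ a ∈ s, 0 ≤ F a) :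
    0 ≤ (s.map F).sum :=
  Multiset.sum_nonneg fun x hx => by
    obtain ⟨a, ha, rfl⟩ := Multiset.mem_map.1 hx; exact h a ha

theorem sum_map_orders_bin_nonneg {s t : BinTerTree ι} {F : List ι → ℚ}
    (h : ∀ x z : List ι, (x + z : Multiset ι) = t.leaves →
      0 ≤ (s.orders.map fun a => F (x ++ a ++ z)).sum) : 0 ≤ ((bin s t).orders.map F).sum := by
  rw [orders_bin_comm, sum_map_orders_bin]
  refine sum_map_nonneg fun b hb => ?_
  rw [Multiset.sum_map_add]
  refine add_nonneg ?_ ?_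
  · simpa using h b [] (by simpa using coe_of_mem_orders hb)
  · simpa using h [] b (by simpa using coe_of_mem_orders hb)

theorem sum_map_orders_tri_nonneg {s t u : BinTerTree ι} {F : List ι → ℚ}
    (h : ∀ x z : List ι, (x + z : Multiset ι) = t.leaves + u.leaves →
      0 ≤ (s.orders.map fun a => F (x ++ a ++ z)).sum) : 0 ≤ ((tri s t u).orders.map F).sum := by
  rw [orders_tri_rotate, sum_map_orders_tri]
  refine sum_map_nonneg fun b hb => sum_map_nonneg fun c hc => ?_
  simp only [Multiset.sum_map_add]
  have hbc : (b + c : Multiset ι) = t.leaves + u.leaves := by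
    rw [coe_of_mem_orders hb, coe_of_mem_orders hc]
  refine add_nonneg (add_nonneg ?_ ?_) ?_
  · simpa using h (b ++ c) [] (by simpa using hbc)
  · simpa using h c b (by rw [add_comm, hbc])
  · simpa using h [] (b ++ c) (by simpa using hbc)

end BinTerTree

section EnergyBounds

variable {G : Type*} [AddCommGroup G] [Fintype G] [DecidableEq G] {f : G → ℚ} {c : ℚ}
  {u v : G → ℤ}

theorem energy_add_energy_ge_two_mul (hu : u ≠ 0 → c ≤ energy f u) (hv : v ≠ 0 → c ≤ energy f v)
    (h : 2 * c ≤ energy f (u - v)) : 2 * c ≤ energy f u + energy f v := by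
  by_cases hu0 : u = 0
  · simpa [hu0] using h
  by_cases hv0 : v = 0
  · simpa [hv0] using h
  linarith [hu hu0, hv hv0]

theorem two_mul_energy_add_energy_ge_three_mul (hc : 0 ≤ c) (hu : u ≠ 0 → c ≤ energy f u)
    (hv : v ≠ 0 → c ≤ energy f v) (h : 4 * c ≤ energy f (u - v)) :
    3 * c ≤ 2 * energy f u + energy f v := by
  by_cases hu0 : u = 0
  · simp only [hu0, zero_sub, QuadraticMap.map_neg, QuadraticMap.map_zero] at h ⊢
    linarith
  by_cases hv0 : v = 0
  · simp only [hv0, sub_zero, QuadraticMap.map_zero] at h ⊢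
    linarith
  linarith [hu hu0, hv hv0]

end EnergyBounds

section Reorder

variable {G ι : Type*} [AddCommGroup G] [DecidableEq G] [DecidableEq ι] {d : ι → G} {I : Finset ι}
  {a b c : List ι} {P Q : Prop} [Decidable P] [Decidable Q]

theorem arcSum_of_forall_mem_iff (p : G) (ha : ∀ i ∈ a, (i ∈ I ↔ P)) :
    arcSum d I p a = (if P then 1 else 0 : ℤ) • arc p (a.map d).sum := by
  split_ifs with hP
  · rw [arcSum_of_forall_mem d p fun i hi => (ha i hi).2 hP, one_smul]
  · rw [arcSum_of_forall_notMem d p fun i hi => mt (ha i hi).1 hP, zero_smul]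

theorem arcSum_append_sub_arcSum_append (ha : ∀ i ∈ a, (i ∈ I ↔ P)) (hb : ∀ i ∈ b, (i ∈ I ↔ Q))
    (p : G) (x z : List ι) :
    arcSum d I p (x ++ (a ++ b) ++ z) - arcSum d I p (x ++ (b ++ a) ++ z) =
      ((if P then 1 else 0) - (if Q then 1 else 0) : ℤ) •
        (arc (p + (x.map d).sum) (a.map d).sum -
          arc (p + (x.map d).sum + (b.map d).sum) (a.map d).sum) := by
  simp only [arcSum_append, arcSum_of_forall_mem_iff _ ha, arcSum_of_forall_mem_iff _ hb,
    List.map_append, List.sum_append]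
  generalize p + (x.map d).sum = q, (a.map d).sum = α, (b.map d).sum = β
  have hcomm : arc (q + α) β = arc q β + arc (q + β) α - arc q α := by
    rw [← arc_add, eq_sub_iff_add_eq', ← arc_add, add_comm α β]
  rw [hcomm, add_comm β α]
  module

variable {h : G}

theorem arcSum_rotate (ha : ∀ i ∈ a, (i ∈ I ↔ P)) (hb : ∀ i ∈ b, (i ∈ I ↔ Q))
    (hc : ∀ i ∈ c, (i ∈ I ↔ Q)) (hh : h + h = 0) (hah : (a.map d).sum = h)
    (hbh : (b.map d).sum = h) (hch : (c.map d).sum = h) (p : G) (x z : List ι) :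
    arcSum d I p (x ++ (b ++ c ++ a) ++ z) = arcSum d I p (x ++ (a ++ b ++ c) ++ z) ∧
    arcSum d I p (x ++ (a ++ b ++ c) ++ z) - arcSum d I p (x ++ (c ++ a ++ b) ++ z) =
      (2 * ((if P then 1 else 0) - (if Q then 1 else 0)) : ℤ) • arc (p + (x.map d).sum) h := by
  have hneg (q : G) : arc (q + h) h = -arc q h := by
    simpa [neg_eq_of_add_eq_zero_left hh] using arc_add_neg q h
  simp only [arcSum_append, arcSum_of_forall_mem_iff _ ha, arcSum_of_forall_mem_iff _ hb,
    arcSum_of_forall_mem_iff _ hc, List.map_append, List.sum_append, hah, hbh, hch, hh, zero_add,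
    add_zero, hneg]
  constructor <;> module

end Reorder

section Excess

variable {G ι : Type*} [AddCommGroup G] [Fintype G] [DecidableEq G] [DecidableEq ι]
  {f : G → ℚ} {d : ι → G} {I : Finset ι} {a b c x z : List ι} {P Q R : Prop}

/-- The amount by which the energy of the arcs with labels in `I`, for the ordering `l` of the
labels, exceeds `minVal f`. -/
def excess (f : G → ℚ) (d : ι → G) (I : Finset ι) (l : List ι) : ℚ :=
  energy f (arcSum d I 0 l) - minVal f

theorem energy_smul_of_ne (hPQ : ¬(P ↔ Q)) [Decidable P] [Decidable Q] (k : ℤ) (y : G → ℤ) :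
    energy f ((k * ((if P then 1 else 0) - (if Q then 1 else 0)) : ℤ) • y) =
      k ^ 2 * energy f y := by
  rw [QuadraticMap.map_smul, zsmul_eq_mul]
  by_cases hP : P <;> by_cases hQ : Q <;> simp_all [pow_two]

/-- Every ordering of the labels `L` has nonnegative excess, unless its arcs with labels in `I`
sum to zero. -/
def HasNonnegExcess (f : G → ℚ) (d : ι → G) (I : Finset ι) (L : Multiset ι) : Prop :=
  ∀ l : List ι, (l : Multiset ι) = L → arcSum d I 0 l ≠ 0 → 0 ≤ excess f d I l

variable {L : Multiset ι}

theorem excess_add_excess_swap_nonneg (hf : IsSymm f) (hf0 : f 0 = 0)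
    (hE : HasNonnegExcess f d I L) (hL : (x ++ (a ++ b) ++ z : List ι) = L)
    (ha : ∀ i ∈ a, (i ∈ I ↔ P)) (hb : ∀ i ∈ b, (i ∈ I ↔ Q)) (hPQ : ¬(P ↔ Q))
    (ha0 : (a.map d).sum ≠ 0) (hb0 : (b.map d).sum ≠ 0) :
    0 ≤ excess f d I (x ++ (a ++ b) ++ z) + excess f d I (x ++ (b ++ a) ++ z) := by
  classical
  have hab := hE _ hL
  have hba := hE (x ++ (b ++ a) ++ z) (by rw [← hL]; simp only [← Multiset.coe_add]; abel)
  have hrect : 2 * minVal f ≤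
      energy f (arcSum d I 0 (x ++ (a ++ b) ++ z) - arcSum d I 0 (x ++ (b ++ a) ++ z)) := by
    rw [arcSum_append_sub_arcSum_append ha hb, ← one_mul (_ - _ : ℤ), energy_smul_of_ne hPQ,
      energy_arc_sub_arc hf hf0]
    simpa using two_mul_minVal_le f ha0 hb0
  simp only [excess, sub_nonneg] at hab hba ⊢
  linarith [energy_add_energy_ge_two_mul hab hba hrect]

theorem excess_rotate_nonneg_of_iff (hf : IsSymm f) (hf0 : f 0 = 0) (hmin : 0 ≤ minVal f)
    (hE : HasNonnegExcess f d I L) (hL : (x ++ (a ++ b ++ c) ++ z : List ι) = L)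
    (ha : ∀ i ∈ a, (i ∈ I ↔ P)) (hb : ∀ i ∈ b, (i ∈ I ↔ Q)) (hc : ∀ i ∈ c, (i ∈ I ↔ Q))
    (hPQ : ¬(P ↔ Q)) {h : G} (hh : h + h = 0) (hfh : minVal f ≤ f h)
    (hah : (a.map d).sum = h) (hbh : (b.map d).sum = h) (hch : (c.map d).sum = h) :
    0 ≤ excess f d I (x ++ (a ++ b ++ c) ++ z) + excess f d I (x ++ (b ++ c ++ a) ++ z) +
      excess f d I (x ++ (c ++ a ++ b) ++ z) := by
  classical
  have habc := hE _ hL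
  have hcab := hE (x ++ (c ++ a ++ b) ++ z) (by rw [← hL]; simp only [← Multiset.coe_add]; abel)
  obtain ⟨heq, hsub⟩ := arcSum_rotate ha hb hc hh hah hbh hch 0 x z
  have hfour : 4 * minVal f ≤ energy f
      (arcSum d I 0 (x ++ (a ++ b ++ c) ++ z) - arcSum d I 0 (x ++ (c ++ a ++ b) ++ z)) := by
    rw [hsub, energy_smul_of_ne hPQ, energy_arc hf hf0]
    norm_num
    linarith
  simp only [excess, sub_nonneg, heq] at habc hcab ⊢
  linarith [two_mul_energy_add_energy_ge_three_mul hmin habc hcab hfour]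

theorem excess_rotate_nonneg (hf : IsSymm f) (hf0 : f 0 = 0) (hmin : 0 ≤ minVal f)
    (hE : HasNonnegExcess f d I L) (hL : (x ++ (a ++ b ++ c) ++ z : List ι) = L)
    (ha : ∀ i ∈ a, (i ∈ I ↔ P)) (hb : ∀ i ∈ b, (i ∈ I ↔ Q)) (hc : ∀ i ∈ c, (i ∈ I ↔ R))
    (hPQR : ¬((P ↔ Q) ∧ (Q ↔ R))) {h : G} (hh : h + h = 0) (hfh : minVal f ≤ f h)
    (hah : (a.map d).sum = h) (hbh : (b.map d).sum = h) (hch : (c.map d).sum = h) :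
    0 ≤ excess f d I (x ++ (a ++ b ++ c) ++ z) + excess f d I (x ++ (b ++ c ++ a) ++ z) +
      excess f d I (x ++ (c ++ a ++ b) ++ z) := by
  have hbca : (x ++ (b ++ c ++ a) ++ z : List ι) = L := by
    rw [← hL]; simp only [← Multiset.coe_add]; abel
  have hcab : (x ++ (c ++ a ++ b) ++ z : List ι) = L := by
    rw [← hL]; simp only [← Multiset.coe_add]; abel
  by_cases hQR : Q ↔ R
  · exact excess_rotate_nonneg_of_iff hf hf0 hmin hE hL ha hb (by simpa only [hQR] using hc)
      (by tauto) hh hfh hah hbh hch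
  by_cases hPR : P ↔ R
  · linarith [excess_rotate_nonneg_of_iff hf hf0 hmin hE hbca hb hc (by simpa only [hPR] using ha)
      hQR hh hfh hbh hch hah]
  · linarith [excess_rotate_nonneg_of_iff hf hf0 hmin hE hcab hc ha
      (Q := P) (by simpa only [show Q ↔ P by tauto] using hb) (by tauto) hh hfh hch hah hbh]

end Excess

namespace BinTerTree

variable {G ι : Type*} [AddCommGroup G] [Fintype G] [DecidableEq G] [DecidableEq ι]
  {f : G → ℚ} {d : ι → G} {I : Finset ι} {L : Multiset ι} {s t u : BinTerTree ι} {x z : List ι}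

theorem sum_excess_bin_nonneg_of_not_isSplitBy (hf : IsSymm f) (hf0 : f 0 = 0)
    (hE : HasNonnegExcess f d I L) (hs : s.leafSum d ≠ 0) (ht : t.leafSum d ≠ 0)
    (hI : (bin s t).IsSplitBy I) (hsI : ¬s.IsSplitBy I) (htI : ¬t.IsSplitBy I)
    (hL : x + (bin s t).leaves + z = L) :
    0 ≤ ((bin s t).orders.map fun l => excess f d I (x ++ l ++ z)).sum := by
  obtain ⟨P, hP⟩ := exists_forall_mem_iff_of_not_isSplitBy hsI
  obtain ⟨Q, hQ⟩ := exists_forall_mem_iff_of_not_isSplitBy htI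
  have hPQ : ¬(P ↔ Q) := by
    simp only [IsSplitBy, leaves, Multiset.mem_add] at hI
    grind
  simp only [sum_map_orders_bin]
  refine sum_map_nonneg fun a ha => sum_map_nonneg fun b hb => ?_
  refine excess_add_excess_swap_nonneg hf hf0 hE ?_
    (fun i hi => hP i (mem_leaves_of_mem_orders ha hi))
    (fun i hi => hQ i (mem_leaves_of_mem_orders hb hi)) hPQ
    (by rwa [leafSum_of_mem_orders ha]) (by rwa [leafSum_of_mem_orders hb])
  simp only [← hL, leaves, ← coe_of_mem_orders ha, ← coe_of_mem_orders hb, Multiset.coe_add]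

theorem sum_excess_tri_nonneg_of_not_isSplitBy (hf : IsSymm f) (hf0 : f 0 = 0)
    (hmin : 0 ≤ minVal f) (hE : HasNonnegExcess f d I L) {h : G} (hh : h + h = 0)
    (hfh : minVal f ≤ f h) (hs : s.leafSum d = h) (ht : t.leafSum d = h) (hu : u.leafSum d = h)
    (hI : (tri s t u).IsSplitBy I) (hsI : ¬s.IsSplitBy I) (htI : ¬t.IsSplitBy I)
    (huI : ¬u.IsSplitBy I) (hL : x + (tri s t u).leaves + z = L) :
    0 ≤ ((tri s t u).orders.map fun l => excess f d I (x ++ l ++ z)).sum := by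
  obtain ⟨P, hP⟩ := exists_forall_mem_iff_of_not_isSplitBy hsI
  obtain ⟨Q, hQ⟩ := exists_forall_mem_iff_of_not_isSplitBy htI
  obtain ⟨R, hR⟩ := exists_forall_mem_iff_of_not_isSplitBy huI
  have hPQR : ¬((P ↔ Q) ∧ (Q ↔ R)) := by
    simp only [IsSplitBy, leaves, Multiset.mem_add] at hI
    grind
  simp only [sum_map_orders_tri]
  refine sum_map_nonneg fun a ha => sum_map_nonneg fun b hb => sum_map_nonneg fun c hc => ?_
  refine excess_rotate_nonneg hf hf0 hmin hE ?_
    (fun i hi => hP i (mem_leaves_of_mem_orders ha hi))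
    (fun i hi => hQ i (mem_leaves_of_mem_orders hb hi))
    (fun i hi => hR i (mem_leaves_of_mem_orders hc hi)) hPQR hh hfh
    (by rwa [leafSum_of_mem_orders ha]) (by rwa [leafSum_of_mem_orders hb])
    (by rwa [leafSum_of_mem_orders hc])
  simp only [← hL, leaves, ← coe_of_mem_orders ha, ← coe_of_mem_orders hb, ← coe_of_mem_orders hc,
    Multiset.coe_add]

theorem IsGood.sum_excess_nonneg (hf : IsSymm f) (hf0 : f 0 = 0) (hmin : 0 ≤ minVal f)
    (htwo : ∀ h : G, h ≠ 0 → h + h = 0 → minVal f ≤ f h) (hE : HasNonnegExcess f d I L)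
    (ht : t.IsGood d) (hI : t.IsSplitBy I) (hL : x + t.leaves + z = L) :
    0 ≤ (t.orders.map fun l => excess f d I (x ++ l ++ z)).sum := by
  induction t generalizing x z with
  | leaf i =>
    simp only [IsSplitBy, leaves, Multiset.mem_singleton] at hI
    grind
  | bin s t hs ht' =>
    obtain ⟨hsg, htg, hs0, ht0⟩ := ht
    by_cases hsI : s.IsSplitBy I
    · refine sum_map_orders_bin_nonneg fun x' z' h => ?_
      simpa using hs hsg hsI (x := x ++ x') (z := z' ++ z) (by
        rw [← hL, leaves, ← h]; simp only [← Multiset.coe_add]; abel)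
    by_cases htI : t.IsSplitBy I
    · rw [orders_bin_comm]
      refine sum_map_orders_bin_nonneg fun x' z' h => ?_
      simpa using ht' htg htI (x := x ++ x') (z := z' ++ z) (by
        rw [← hL, leaves, ← h]; simp only [← Multiset.coe_add]; abel)
    exact sum_excess_bin_nonneg_of_not_isSplitBy hf hf0 hE hs0 ht0 hI hsI htI hL
  | tri s t u hs ht' hu' =>
    obtain ⟨hsg, htg, hug, hs0, hss, hts, hus⟩ := ht
    by_cases hsI : s.IsSplitBy I
    · refine sum_map_orders_tri_nonneg fun x' z' h => ?_
      simpa using hs hsg hsI (x := x ++ x') (z := z' ++ z) (by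
        rw [← hL, leaves, add_assoc s.leaves, ← h]; simp only [← Multiset.coe_add]; abel)
    by_cases htI : t.IsSplitBy I
    · rw [orders_tri_rotate]
      refine sum_map_orders_tri_nonneg fun x' z' h => ?_
      simpa using ht' htg htI (x := x ++ x') (z := z' ++ z) (by
        rw [← hL, leaves, add_assoc s.leaves, add_comm s.leaves, add_assoc t.leaves, ← h]
        simp only [← Multiset.coe_add]; abel)
    by_cases huI : u.IsSplitBy I
    · rw [← orders_tri_rotate]
      refine sum_map_orders_tri_nonneg fun x' z' h => ?_
      simpa using hu' hug huI (x := x ++ x') (z := z' ++ z) (by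
        rw [← hL, leaves, ← h]; simp only [← Multiset.coe_add]; abel)
    exact sum_excess_tri_nonneg_of_not_isSplitBy hf hf0 hmin hE hss (htwo _ hs0 hss) rfl hts hus
      hI hsI htI huI hL

end BinTerTree

/-! ### Maximal laminar families -/

section Laminar

variable {G ι : Type*} [AddCommGroup G] {d : ι → G} {𝓕 𝓜 : Set (Finset ι)}
  {A B C F S U V : Finset ι}

/-- One of the two sets contains the other, or they are disjoint. -/
def NestedOrDisjoint (A B : Finset ι) : Prop := A ⊆ B ∨ B ⊆ A ∨ Disjoint A B

theorem NestedOrDisjoint.symm (h : NestedOrDisjoint A B) : NestedOrDisjoint B A := by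
  rcases h with h | h | h
  exacts [.inr (.inl h), .inl h, .inr (.inr h.symm)]

/-- A laminar family of sets of indices over each of which `d` has nonzero sum. -/
structure IsLaminar (d : ι → G) (𝓕 : Set (Finset ι)) : Prop where
  sum_ne_zero : ∀ F ∈ 𝓕, ∑ i ∈ F, d i ≠ 0
  nestedOrDisjoint : ∀ A ∈ 𝓕, ∀ B ∈ 𝓕, NestedOrDisjoint A B

theorem IsLaminar.nonempty (h : IsLaminar d 𝓕) (hF : F ∈ 𝓕) : F.Nonempty :=
  Finset.nonempty_of_sum_ne_zero (h.sum_ne_zero F hF)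

theorem IsLaminar.mem_of_maximal (h𝓜 : Maximal (IsLaminar d) 𝓜) (hA : ∑ i ∈ A, d i ≠ 0)
    (hcomp : ∀ F ∈ 𝓜, NestedOrDisjoint F A) : A ∈ 𝓜 := by
  refine h𝓜.2 ⟨?_, ?_⟩ (Set.subset_insert A 𝓜) (Set.mem_insert A 𝓜)
  · rintro F (rfl | hF)
    exacts [hA, h𝓜.1.sum_ne_zero F hF]
  · rintro F (rfl | hF) F' (rfl | hF')
    exacts [.inl subset_rfl, (hcomp F' hF').symm, hcomp F hF, h𝓜.1.nestedOrDisjoint F hF F' hF']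

theorem IsLaminar.singleton_mem_of_maximal (h𝓜 : Maximal (IsLaminar d) 𝓜) {i : ι}
    (hi : d i ≠ 0) : {i} ∈ 𝓜 := by
  refine mem_of_maximal h𝓜 (by simpa using hi) fun F _ => ?_
  by_cases h : i ∈ F
  · exact .inr (.inl (Finset.singleton_subset_iff.2 h))
  · exact .inr (.inr (Finset.disjoint_singleton_right.2 h))

/-- A subset of `S` that is not crossed by the members of `𝓜` strictly contained in `S`. -/
structure IsSaturated (𝓜 : Set (Finset ι)) (S U : Finset ι) : Prop where
  subset : U ⊆ S
  subset_or_disjoint : ∀ F ∈ 𝓜, F ⊂ S → F ⊆ U ∨ Disjoint F U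

theorem IsSaturated.mem_of_maximal (hU : IsSaturated 𝓜 S U) (h𝓜 : Maximal (IsLaminar d) 𝓜)
    (hS : S ∈ 𝓜) (h0 : ∑ i ∈ U, d i ≠ 0) : U ∈ 𝓜 := by
  refine IsLaminar.mem_of_maximal h𝓜 h0 fun F hF => ?_
  rcases h𝓜.1.nestedOrDisjoint F hF S hS with h | h | h
  · obtain rfl | h := h.eq_or_ssubset
    · exact .inr (.inl hU.subset)
    · exact (hU.subset_or_disjoint F hF h).imp_right .inr
  · exact .inr (.inl (hU.subset.trans h))
  · exact .inr (.inr (h.mono_right hU.subset))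

/-- `C` is a maximal member of `𝓜` strictly contained in `S`. -/
def IsChild (𝓜 : Set (Finset ι)) (S C : Finset ι) : Prop :=
  Maximal (fun F => F ∈ 𝓜 ∧ F ⊂ S) C

theorem exists_isChild_of_mem {i : ι} (hi : i ∈ S) (h : {i} ∈ 𝓜) (hS : S ≠ {i}) :
    ∃ C, IsChild 𝓜 S C ∧ i ∈ C := by
  have hfin : {F : Finset ι | F ∈ 𝓜 ∧ F ⊂ S}.Finite :=
    S.powerset.finite_toSet.subset fun F hF => Finset.mem_coe.2 (Finset.mem_powerset.2 hF.2.subset)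
  obtain ⟨C, hiC, hC⟩ := hfin.exists_le_maximal
    (a := {i}) ⟨h, (Finset.singleton_subset_iff.2 hi).ssubset_of_ne hS.symm⟩
  exact ⟨C, hC, Finset.singleton_subset_iff.1 hiC⟩

theorem IsChild.isSaturated (hC : IsChild 𝓜 S C) (h𝓜 : IsLaminar d 𝓜) : IsSaturated 𝓜 S C := by
  refine ⟨hC.1.2.subset, fun F hF hFS => ?_⟩
  rcases h𝓜.nestedOrDisjoint F hF C hC.1.1 with h | h | h
  · exact .inl h
  · exact .inl (hC.2 ⟨hF, hFS⟩ h)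
  · exact .inr h

theorem IsChild.disjoint (hA : IsChild 𝓜 S A) (hB : IsChild 𝓜 S B) (h𝓜 : IsLaminar d 𝓜)
    (hAB : A ≠ B) : Disjoint A B :=
  ((hB.isSaturated h𝓜).subset_or_disjoint A hA.1.1 hA.1.2).resolve_left fun h =>
    hAB (h.antisymm (hA.2 hB.1 h))

theorem IsChild.sum_eq_zero_of_ssubset (hC : IsChild 𝓜 S C) (h𝓜 : Maximal (IsLaminar d) 𝓜)
    (hS : S ∈ 𝓜) (hU : IsSaturated 𝓜 S U) (hUS : U ≠ S) (hCU : C ⊂ U) : ∑ i ∈ U, d i = 0 := by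
  by_contra h0
  exact hC.not_prop_of_gt hCU ⟨hU.mem_of_maximal h𝓜 hS h0, hU.subset.ssubset_of_ne hUS⟩

namespace BinTerTree

/-- The tree `t` is good, its set of leaves is `S`, and all members of `𝓜` contained in `S` are
among its blocks. -/
structure Realizes (d : ι → G) (𝓜 : Set (Finset ι)) (S : Finset ι) (t : BinTerTree ι) : Prop where
  leaves_eq : t.leaves = S.val
  isGood : t.IsGood d
  val_mem_blocks : ∀ F ∈ 𝓜, F ⊆ S → F.val ∈ t.blocks

theorem Realizes.leafSum_eq {t : BinTerTree ι} (ht : t.Realizes d 𝓜 S) :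
    t.leafSum d = ∑ i ∈ S, d i := by
  rw [leafSum, ht.leaves_eq]
  rfl

end BinTerTree

section

variable [DecidableEq ι]

theorem IsSaturated.union (hU : IsSaturated 𝓜 S U) (hV : IsSaturated 𝓜 S V) :
    IsSaturated 𝓜 S (U ∪ V) := by
  refine ⟨Finset.union_subset hU.subset hV.subset, fun F hF hFS => ?_⟩
  rcases hU.subset_or_disjoint F hF hFS with h | h
  · exact .inl (h.trans Finset.subset_union_left)
  rcases hV.subset_or_disjoint F hF hFS with h' | h'
  · exact .inl (h'.trans Finset.subset_union_right)
  · exact .inr (Finset.disjoint_union_right.2 ⟨h, h'⟩)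

theorem IsSaturated.subset_or_subset_of_subset_union (hU : IsSaturated 𝓜 S U)
    (hV : IsSaturated 𝓜 S V) (hF : F ∈ 𝓜) (hFS : F ⊂ S) (hne : F.Nonempty) (h : F ⊆ U ∪ V) :
    F ⊆ U ∨ F ⊆ V := by
  refine (hU.subset_or_disjoint F hF hFS).imp_right fun hFU => ?_
  refine (hV.subset_or_disjoint F hF hFS).resolve_right fun hFV => hne.ne_empty ?_
  exact (Finset.disjoint_union_right.2 ⟨hFU, hFV⟩).eq_bot_of_le h

theorem IsChild.sum_add_sum_eq_zero (hA : IsChild 𝓜 S A) (hB : IsChild 𝓜 S B)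
    (h𝓜 : Maximal (IsLaminar d) 𝓜) (hS : S ∈ 𝓜) (hAB : A ≠ B) (hU : A ∪ B ≠ S) :
    ∑ i ∈ A, d i + ∑ i ∈ B, d i = 0 := by
  have hdisj := hA.disjoint hB h𝓜.1 hAB
  rw [← Finset.sum_union hdisj]
  refine hA.sum_eq_zero_of_ssubset h𝓜 hS ((hA.isSaturated h𝓜.1).union (hB.isSaturated h𝓜.1)) hU ?_
  rw [Finset.ssubset_iff_subset_ne, ne_comm, Ne, Finset.union_eq_left]
  exact ⟨Finset.subset_union_left, fun h => (h𝓜.1.nonempty hB.1.1).ne_empty (hdisj.eq_bot_of_ge h)⟩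

theorem IsChild.union_union_eq (hA : IsChild 𝓜 S A) (hB : IsChild 𝓜 S B) (hC : IsChild 𝓜 S C)
    (h𝓜 : Maximal (IsLaminar d) 𝓜) (hS : S ∈ 𝓜) (hAB : A ≠ B) (hAC : A ≠ C) (hBC : B ≠ C)
    (hU : A ∪ B ≠ S) : A ∪ B ∪ C = S := by
  by_contra hne
  have hAsat := hA.isSaturated h𝓜.1
  have hBsat := hB.isSaturated h𝓜.1
  have hdisj : Disjoint (A ∪ B) C := Finset.disjoint_union_left.2
    ⟨hA.disjoint hC h𝓜.1 hAC, hB.disjoint hC h𝓜.1 hBC⟩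
  have hsum : ∑ i ∈ A ∪ B ∪ C, d i = 0 := by
    refine hC.sum_eq_zero_of_ssubset h𝓜 hS ((hAsat.union hBsat).union (hC.isSaturated h𝓜.1)) hne ?_
    rw [Finset.ssubset_iff_subset_ne, ne_comm, Ne, Finset.union_eq_right]
    exact ⟨Finset.subset_union_right, fun h => (h𝓜.1.nonempty hA.1.1).ne_empty
      (hA.disjoint hC h𝓜.1 hAC |>.eq_bot_of_le (Finset.subset_union_left.trans h))⟩
  rw [Finset.sum_union hdisj, Finset.sum_union (hA.disjoint hB h𝓜.1 hAB),
    hA.sum_add_sum_eq_zero hB h𝓜 hS hAB hU, zero_add] at hsum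
  exact h𝓜.1.sum_ne_zero C hC.1.1 hsum

theorem exists_isChild_union_eq (h𝓜 : Maximal (IsLaminar d) 𝓜) (hS : S ∈ 𝓜)
    (hd : ∀ i ∈ S, d i ≠ 0) (hS1 : ∀ i, S ≠ {i}) :
    (∃ A B, IsChild 𝓜 S A ∧ IsChild 𝓜 S B ∧ A ≠ B ∧ A ∪ B = S) ∨
      ∃ A B C, IsChild 𝓜 S A ∧ IsChild 𝓜 S B ∧ IsChild 𝓜 S C ∧ A ≠ B ∧ A ≠ C ∧ B ≠ C ∧
        A ∪ B ∪ C = S ∧ ∑ i ∈ A, d i + ∑ i ∈ A, d i = 0 ∧ ∑ i ∈ B, d i = ∑ i ∈ A, d i ∧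
        ∑ i ∈ C, d i = ∑ i ∈ A, d i := by
  have hchild (i : ι) (hi : i ∈ S) : ∃ C, IsChild 𝓜 S C ∧ i ∈ C :=
    exists_isChild_of_mem hi (IsLaminar.singleton_mem_of_maximal h𝓜 (hd i hi)) (hS1 i)
  obtain ⟨x, hx⟩ := h𝓜.1.nonempty hS
  obtain ⟨A, hA, hxA⟩ := hchild x hx
  obtain ⟨y, hy, hyA⟩ := Finset.exists_of_ssubset hA.1.2
  obtain ⟨B, hB, hyB⟩ := hchild y hy
  have hAB : A ≠ B := fun h => hyA (h ▸ hyB)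
  by_cases hU : A ∪ B = S
  · exact .inl ⟨A, B, hA, hB, hAB, hU⟩
  obtain ⟨z, hz, hzU⟩ := Finset.exists_of_ssubset
    ((Finset.union_subset hA.1.2.subset hB.1.2.subset).ssubset_of_ne hU)
  obtain ⟨C, hC, hzC⟩ := hchild z hz
  rw [Finset.mem_union, not_or] at hzU
  have hAC : A ≠ C := fun h => hzU.1 (h ▸ hzC)
  have hBC : B ≠ C := fun h => hzU.2 (h ▸ hzC)
  have hnotMem {D E : Finset ι} {i : ι} (hD : IsChild 𝓜 S D) (hE : IsChild 𝓜 S E) (hDE : D ≠ E)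
      (hi : i ∈ D) : i ∉ E := Finset.disjoint_left.1 (hD.disjoint hE h𝓜.1 hDE) hi
  have hAC' : A ∪ C ≠ S := fun h => by
    rw [← h, Finset.mem_union] at hy
    exact hy.elim hyA (hnotMem hB hC hBC hyB)
  have hBC' : B ∪ C ≠ S := fun h => by
    rw [← h, Finset.mem_union] at hx
    exact hx.elim (hnotMem hA hB hAB hxA) (hnotMem hA hC hAC hxA)
  have sAB := hA.sum_add_sum_eq_zero hB h𝓜 hS hAB hU
  have sAC := hA.sum_add_sum_eq_zero hC h𝓜 hS hAC hAC'
  have sBC := hB.sum_add_sum_eq_zero hC h𝓜 hS hBC hBC'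
  have eBC := add_left_cancel (sAB.trans sAC.symm)
  have eAB : ∑ i ∈ B, d i = ∑ i ∈ A, d i := add_right_cancel (sBC.trans sAC.symm)
  exact .inr ⟨A, B, C, hA, hB, hC, hAB, hAC, hBC,
    hA.union_union_eq hB hC h𝓜 hS hAB hAC hBC hU, by rwa [eAB] at sAB, eAB, eBC.symm.trans eAB⟩

theorem val_add_val_of_disjoint (h : Disjoint A B) : A.val + B.val = (A ∪ B).val := by
  rw [← Finset.disjUnion_eq_union A B h, Finset.disjUnion_val]

namespace BinTerTree

variable {s t u : BinTerTree ι}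

theorem Realizes.bin (hs : s.Realizes d 𝓜 A) (ht : t.Realizes d 𝓜 B) (h𝓜 : IsLaminar d 𝓜)
    (hA : IsChild 𝓜 S A) (hB : IsChild 𝓜 S B) (hAB : A ≠ B) (hU : A ∪ B = S) :
    (BinTerTree.bin s t).Realizes d 𝓜 S := by
  have hleaves : (BinTerTree.bin s t).leaves = S.val := by
    rw [leaves, hs.leaves_eq, ht.leaves_eq, val_add_val_of_disjoint (hA.disjoint hB h𝓜 hAB), hU]
  refine ⟨hleaves, ⟨hs.isGood, ht.isGood, ?_, ?_⟩, fun F hF hFS => ?_⟩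
  · exact hs.leafSum_eq ▸ h𝓜.sum_ne_zero A hA.1.1
  · exact ht.leafSum_eq ▸ h𝓜.sum_ne_zero B hB.1.1
  obtain rfl | hssub := hFS.eq_or_ssubset
  · exact .inl hleaves.symm
  · exact .inr (((hA.isSaturated h𝓜).subset_or_subset_of_subset_union (hB.isSaturated h𝓜) hF hssub
      (h𝓜.nonempty hF) (hU ▸ hFS)).imp (hs.val_mem_blocks F hF) (ht.val_mem_blocks F hF))

theorem Realizes.tri (hs : s.Realizes d 𝓜 A) (ht : t.Realizes d 𝓜 B) (hu : u.Realizes d 𝓜 C)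
    (h𝓜 : IsLaminar d 𝓜) (hA : IsChild 𝓜 S A) (hB : IsChild 𝓜 S B) (hC : IsChild 𝓜 S C)
    (hAB : A ≠ B) (hAC : A ≠ C) (hBC : B ≠ C) (hU : A ∪ B ∪ C = S)
    (h2 : ∑ i ∈ A, d i + ∑ i ∈ A, d i = 0) (eB : ∑ i ∈ B, d i = ∑ i ∈ A, d i)
    (eC : ∑ i ∈ C, d i = ∑ i ∈ A, d i) : (BinTerTree.tri s t u).Realizes d 𝓜 S := by
  have hdisj : Disjoint (A ∪ B) C :=
    Finset.disjoint_union_left.2 ⟨hA.disjoint hC h𝓜 hAC, hB.disjoint hC h𝓜 hBC⟩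
  have hleaves : (BinTerTree.tri s t u).leaves = S.val := by
    rw [leaves, hs.leaves_eq, ht.leaves_eq, hu.leaves_eq,
      val_add_val_of_disjoint (hA.disjoint hB h𝓜 hAB), val_add_val_of_disjoint hdisj, hU]
  refine ⟨hleaves, ⟨hs.isGood, ht.isGood, hu.isGood, ?_⟩, fun F hF hFS => ?_⟩
  · rw [hs.leafSum_eq, ht.leafSum_eq, hu.leafSum_eq]
    exact ⟨h𝓜.sum_ne_zero A hA.1.1, h2, eB, eC⟩
  obtain rfl | hssub := hFS.eq_or_ssubset
  · exact .inl hleaves.symm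
  have hAsat := hA.isSaturated h𝓜
  have hBsat := hB.isSaturated h𝓜
  have hne := h𝓜.nonempty hF
  refine .inr (((hAsat.union hBsat).subset_or_subset_of_subset_union (hC.isSaturated h𝓜) hF hssub
    hne (hU ▸ hFS)).imp (fun hFAB => ?_) (hu.val_mem_blocks F hF))
  exact (hAsat.subset_or_subset_of_subset_union hBsat hF hssub hne hFAB).imp
    (hs.val_mem_blocks F hF) (ht.val_mem_blocks F hF)

end BinTerTree

end

theorem exists_realizes_of_maximal (h𝓜 : Maximal (IsLaminar d) 𝓜) (hS : S ∈ 𝓜)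
    (hd : ∀ i ∈ S, d i ≠ 0) : ∃ t : BinTerTree ι, t.Realizes d 𝓜 S := by
  classical
  induction S using Finset.strongInduction with | H S ih =>
  have hchild {C : Finset ι} (hC : IsChild 𝓜 S C) :=
    ih C hC.1.2 hC.1.1 fun i hi => hd i (hC.1.2.subset hi)
  by_cases hS1 : ∃ i, S = {i}
  · obtain ⟨i, rfl⟩ := hS1
    exact ⟨.leaf i, rfl, trivial, fun F hF hFi =>
      congrArg Finset.val ((h𝓜.1.nonempty hF).subset_singleton_iff.1 hFi)⟩
  obtain ⟨A, B, hA, hB, hAB, hU⟩ | ⟨A, B, C, hA, hB, hC, hAB, hAC, hBC, hU, h2, eB, eC⟩ :=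
    exists_isChild_union_eq h𝓜 hS hd (not_exists.1 hS1)
  · obtain ⟨⟨s, hs⟩, t, ht⟩ := And.intro (hchild hA) (hchild hB)
    exact ⟨.bin s t, hs.bin ht h𝓜.1 hA hB hAB hU⟩
  · obtain ⟨⟨s, hs⟩, ⟨t, ht⟩, u, hu⟩ :=
      And.intro (hchild hA) (And.intro (hchild hB) (hchild hC))
    exact ⟨.tri s t u, hs.tri ht hu h𝓜.1 hA hB hC hAB hAC hBC hU h2 eB eC⟩

theorem IsLaminar.exists_realizes [Finite ι] (h𝓕 : IsLaminar d 𝓕) (hS : S ∈ 𝓕)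
    (hd : ∀ i ∈ S, d i ≠ 0) : ∃ t : BinTerTree ι, t.Realizes d 𝓕 S := by
  obtain ⟨𝓜, hle, h𝓜⟩ := Finite.exists_le_maximal h𝓕
  obtain ⟨t, ht⟩ := exists_realizes_of_maximal h𝓜 (hle hS) hd
  exact ⟨t, ht.leaves_eq, ht.isGood, fun F hF => ht.val_mem_blocks F (hle hF)⟩

end Laminar

/-! ### Partitions of a labeled tree -/

section TreePartition

variable {V : Type*} {T : SimpleGraph V}

theorem reachable_deleteEdges_or (hT : T.Connected) (u v x : V) :
    (T.deleteEdges {s(u, v)}).Reachable u x ∨ (T.deleteEdges {s(u, v)}).Reachable v x := by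
  obtain ⟨p⟩ := hT.preconnected x u
  induction p with
  | nil => exact .inl .rfl
  | @cons x y u hxy p ih =>
    by_cases he : s(x, y) = s(u, v)
    · rcases Sym2.eq_iff.1 he with ⟨rfl, -⟩ | ⟨rfl, -⟩
      exacts [.inl .rfl, .inr .rfl]
    · have hyx : (T.deleteEdges {s(u, v)}).Adj y x :=
        SimpleGraph.deleteEdges_adj.2 ⟨hxy.symm, by rwa [Set.mem_singleton_iff, Sym2.eq_swap]⟩
      exact ih.imp (·.trans hyx.reachable) (·.trans hyx.reachable)

theorem not_reachable_deleteEdges (hT : T.IsAcyclic) {u v : V} (huv : T.Adj u v) :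
    ¬(T.deleteEdges {s(u, v)}).Reachable u v :=
  SimpleGraph.isBridge_iff.1 (SimpleGraph.isAcyclic_iff_forall_adj_isBridge.1 hT huv)

theorem reachable_deleteEdges_of_not_reachable {e : Sym2 V} {u u' v' x : V}
    (hx : (T.deleteEdges {e}).Reachable u x) (hu' : ¬(T.deleteEdges {e}).Reachable u u') :
    (T.deleteEdges {s(u', v')}).Reachable u x := by
  classical
  obtain ⟨p⟩ := hx
  refine ⟨p.transfer _ fun e' he' => ?_⟩
  have hmem := p.edges_subset_edgeSet he'
  rw [SimpleGraph.edgeSet_deleteEdges] at hmem ⊢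
  refine ⟨hmem.1, fun h => hu' ?_⟩
  obtain rfl := Set.mem_singleton_iff.1 h
  exact ⟨p.takeUntil u' (p.fst_mem_support_of_mem_edges he')⟩

variable {n : ℕ} {leaf : Fin n → V} {I J : Finset (Fin n)} {u v u' v' : V}

theorem mem_compl_iff_reachable (hT : T.IsTree) (huv : T.Adj u v)
    (hI : ∀ i, i ∈ I ↔ (T.deleteEdges {s(u, v)}).Reachable u (leaf i)) (i : Fin n) :
    i ∈ Iᶜ ↔ (T.deleteEdges {s(v, u)}).Reachable v (leaf i) := by
  rw [Finset.mem_compl, hI, Sym2.eq_swap (a := v)]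
  exact ⟨(reachable_deleteEdges_or hT.connected u v _).resolve_left, fun h h' =>
    not_reachable_deleteEdges hT.isAcyclic huv (h'.trans h.symm)⟩

theorem IsTreePartition.compl (hI : IsTreePartition T leaf I) (hT : T.IsTree) :
    IsTreePartition T leaf Iᶜ := by
  obtain ⟨u, v, huv, hI⟩ := hI
  exact ⟨v, u, huv.symm, mem_compl_iff_reachable hT huv hI⟩

theorem subset_or_disjoint_of_not_reachable (hT : T.IsTree) (huv' : T.Adj u' v')
    (hI : ∀ i, i ∈ I ↔ (T.deleteEdges {s(u, v)}).Reachable u (leaf i))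
    (hJ : ∀ i, i ∈ J ↔ (T.deleteEdges {s(u', v')}).Reachable u' (leaf i))
    (hu' : ¬(T.deleteEdges {s(u, v)}).Reachable u u') : I ⊆ J ∨ Disjoint I J := by
  have hreach {i : Fin n} (hi : i ∈ I) : (T.deleteEdges {s(u', v')}).Reachable u (leaf i) :=
    reachable_deleteEdges_of_not_reachable ((hI i).1 hi) hu'
  refine (reachable_deleteEdges_or hT.connected u' v' u).imp
    (fun h i hi => (hJ i).2 (h.trans (hreach hi))) fun h => ?_
  exact Finset.disjoint_left.2 fun i hi hiJ => not_reachable_deleteEdges hT.isAcyclic huv'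
    (((hJ i).1 hiJ).trans (h.trans (hreach hi)).symm)

theorem IsTreePartition.crossFree (hI : IsTreePartition T leaf I) (hJ : IsTreePartition T leaf J)
    (hT : T.IsTree) : NestedOrDisjoint I J ∨ I ∪ J = Finset.univ := by
  obtain ⟨⟨u, v, huv, hI⟩, u', v', huv', hJ⟩ := And.intro hI hJ
  by_cases hu' : (T.deleteEdges {s(u, v)}).Reachable u u'
  · have hvu' : ¬(T.deleteEdges {s(v, u)}).Reachable v u' := fun h =>
      not_reachable_deleteEdges hT.isAcyclic huv (hu'.trans (Sym2.eq_swap ▸ h).symm)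
    obtain h | h := subset_or_disjoint_of_not_reachable hT huv'
      (mem_compl_iff_reachable hT huv hI) hJ hvu'
    · exact .inr (codisjoint_iff.1 (codisjoint_iff_compl_le_right.2 h))
    · exact .inl (.inr (.inl (disjoint_compl_left_iff.1 h)))
  · exact .inl ((subset_or_disjoint_of_not_reachable hT huv' hI hJ hu').imp_right .inr)

theorem IsLabeledTree.isTreePartition_singleton (h : IsLabeledTree T leaf) (i : Fin n) :
    IsTreePartition T leaf {i} := by
  obtain ⟨v, hv⟩ := Set.ncard_eq_one.1 ((h.leaf_iff (leaf i)).2 ⟨i, rfl⟩)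
  have hadj (x : V) : T.Adj (leaf i) x ↔ x = v := by
    rw [← SimpleGraph.mem_neighborSet, hv, Set.mem_singleton_iff]
  refine ⟨leaf i, v, (hadj v).2 rfl, fun j => ?_⟩
  rw [Finset.mem_singleton]
  refine ⟨fun hj => hj ▸ .rfl, fun ⟨p⟩ => h.leaf_injective ?_⟩
  generalize leaf j = x at p
  cases p with
  | nil => rfl
  | cons hxy p =>
    rw [SimpleGraph.deleteEdges_adj, hadj] at hxy
    obtain ⟨rfl, hxy⟩ := hxy
    exact absurd rfl hxy

end TreePartition

/-! ### Weightings from averaged orderings -/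

section MeanWeighting

variable {n : ℕ} {α : Type*} {s : Multiset α} {w : α → Weighting n} {I : Finset (Fin n)} {c : ℚ}

theorem flow_add (w w' : Weighting n) (I : Finset (Fin n)) :
    flow (w + w') I = flow w I + flow w' I := by
  simp only [flow, Pi.add_apply, Finset.sum_add_distrib]

theorem flow_smul (c : ℚ) (w : Weighting n) (I : Finset (Fin n)) :
    flow (c • w) I = c * flow w I := by
  simp only [flow, Pi.smul_apply, smul_eq_mul, Finset.mul_sum]

/-- The average of the weightings `w a` over the multiset `s`, which is zero if `s` is empty. -/
def meanWeighting (s : Multiset α) (w : α → Weighting n) : Weighting n :=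
  (s.card : ℚ)⁻¹ • (s.map w).sum

theorem flow_meanWeighting (s : Multiset α) (w : α → Weighting n) (I : Finset (Fin n)) :
    flow (meanWeighting s w) I = (s.card : ℚ)⁻¹ * (s.map fun a => flow (w a) I).sum := by
  rw [meanWeighting, flow_smul]
  congr 1
  induction s using Multiset.induction_on with
  | empty => simp [flow]
  | cons a s ih => simp only [Multiset.map_cons, Multiset.sum_cons, flow_add, ih]

theorem flow_meanWeighting_of_forall_eq (hs : s ≠ 0) (h : ∀ a ∈ s, flow (w a) I = c) :
    flow (meanWeighting s w) I = c := by
  have hcard : (s.card : ℚ) ≠ 0 := by simpa using hs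
  rw [flow_meanWeighting, Multiset.map_congr rfl h, Multiset.map_const', Multiset.sum_replicate,
    nsmul_eq_mul, inv_mul_cancel_left₀ hcard]

theorem le_flow_meanWeighting (hs : s ≠ 0) (h : 0 ≤ (s.map fun a => flow (w a) I - c).sum) :
    c ≤ flow (meanWeighting s w) I := by
  have hcard : (0 : ℚ) < s.card := by exact_mod_cast Multiset.card_pos.2 hs
  rw [Multiset.sum_map_sub, Multiset.map_const', Multiset.sum_replicate, nsmul_eq_mul,
    sub_nonneg] at h
  rwa [flow_meanWeighting, le_inv_mul_iff₀ hcard]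

end MeanWeighting

section CrossFree

open BinTerTree

variable {G : Type*} [AddCommGroup G] {f : G → ℚ} {n : ℕ} {d : Fin n → G} {r : Fin n}
  {t : BinTerTree (Fin n)} {w : List (Fin n) → Weighting n} {I : Finset (Fin n)}
  {𝓣 : Set (Finset (Fin n))}

theorem sum_compl_eq_neg (hd : ∑ i, d i = 0) (I : Finset (Fin n)) :
    ∑ i ∈ Iᶜ, d i = -∑ i ∈ I, d i :=
  eq_neg_of_add_eq_zero_right (by rw [Finset.sum_add_sum_compl, hd])

theorem isLaminar_insert_compl_singleton (hd : ∑ i, d i = 0) (hr : d r ≠ 0)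
    (hcross : ∀ I ∈ 𝓣, ∀ J ∈ 𝓣, NestedOrDisjoint I J ∨ I ∪ J = Finset.univ)
    (hsum : ∀ I ∈ 𝓣, ∑ i ∈ I, d i ≠ 0) : IsLaminar d (insert {r}ᶜ {F ∈ 𝓣 | r ∉ F}) where
  sum_ne_zero := by
    rintro F (rfl | ⟨hF, -⟩)
    · rwa [sum_compl_eq_neg hd, Finset.sum_singleton, neg_ne_zero]
    · exact hsum F hF
  nestedOrDisjoint := by
    have hsubset {F : Finset (Fin n)} (hF : r ∉ F) : F ⊆ {r}ᶜ := by simpa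
    rintro A (rfl | ⟨hA, hrA⟩) B (rfl | ⟨hB, hrB⟩)
    · exact .inl subset_rfl
    · exact .inr (.inl (hsubset hrB))
    · exact .inl (hsubset hrA)
    · refine (hcross A hA B hB).resolve_right fun h => ?_
      have := h ▸ Finset.mem_univ r
      simp [hrA, hrB] at this

theorem coe_cons_of_mem_orders (ht : t.leaves = ({r}ᶜ : Finset (Fin n)).val)
    {l : List (Fin n)} (hl : l ∈ t.orders) :
    ((r :: l : List (Fin n)) : Multiset (Fin n)) = Finset.univ.val := by
  rw [← Multiset.cons_coe, coe_of_mem_orders hl, ht,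
    ← Finset.insert_val_of_notMem (by simp), Finset.insert_compl_self]

theorem isSplitBy_of_isProper (ht : t.leaves = ({r}ᶜ : Finset (Fin n)).val) (hI : IsProper I) :
    t.IsSplitBy I := by
  obtain ⟨i, hi, hir⟩ := Finset.exists_mem_ne hI.1 r
  obtain ⟨j, hj, hjr⟩ := Finset.exists_mem_ne hI.2 r
  exact ⟨i, by simpa [ht], j, by simpa [ht], hi, Finset.mem_compl.1 hj⟩

theorem flow_meanWeighting_of_mem_blocks (hI : I.val ∈ t.blocks)
    (hw : ∀ l ∈ t.orders, IsAdapted f d (w l) (r :: l)) :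
    flow (meanWeighting t.orders w) I = f (∑ i ∈ I, d i) := by
  refine flow_meanWeighting_of_forall_eq t.orders_ne_zero fun l hl => ?_
  obtain ⟨s, hs, hsl⟩ := exists_infix_of_mem_blocks hI hl
  have hsI : s.toFinset = I := by
    rw [← List.toFinset_coe, hs, Finset.val_toFinset]
  rw [← hsI, hw l hl s (List.infix_cons hsl), hsI, ← Multiset.sum_coe, ← Multiset.map_coe, hs]
  rfl

variable [Fintype G] [DecidableEq G]

theorem minVal_le_flow_meanWeighting (hG : 3 ≤ Fintype.card G) (hf : IsSymm f) (hf0 : f 0 = 0)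
    (hE : ∀ y : G → ℤ, y ≠ 0 → ∑ u, y u = 0 → ∑ u, y u • u = 0 → minVal f ≤ energy f y)
    (hd : ∑ i, d i = 0) (ht : t.leaves = ({r}ᶜ : Finset (Fin n)).val) (hgood : t.IsGood d)
    (hw : ∀ l ∈ t.orders, IsAdapted f d (w l) (r :: l)) (hI : IsProper I)
    (hsum : ∑ i ∈ I, d i = 0) : minVal f ≤ flow (meanWeighting t.orders w) I := by
  have hexcess : HasNonnegExcess f d I Finset.univ.val := fun l hl hne =>
    sub_nonneg.2 (hE _ hne (sum_arcSum d I 0 l)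
      ((sum_arcSum_smul_of_coe_eq_univ d I 0 hl).trans hsum))
  have hleaves : (([r] : List (Fin n)) + t.leaves + ([] : List (Fin n)) : Multiset (Fin n)) =
      Finset.univ.val := by
    obtain ⟨l, hl⟩ := Multiset.exists_mem_of_ne_zero t.orders_ne_zero
    rw [← coe_cons_of_mem_orders ht hl, ← coe_of_mem_orders hl]
    simp
  have key := hgood.sum_excess_nonneg hf hf0 (minVal_nonneg hf hf0 hE)
    (fun h => minVal_le_of_add_self_eq_zero hG) hexcess (isSplitBy_of_isProper ht hI) hleaves
  refine le_flow_meanWeighting t.orders_ne_zero (key.trans_eq ?_)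
  refine congrArg Multiset.sum (Multiset.map_congr rfl fun l hl => ?_)
  rw [(hw l hl).flow_eq_energy hf hd (coe_cons_of_mem_orders ht hl)]
  simp [excess]

theorem isAdmissible_meanWeighting (hG : 3 ≤ Fintype.card G) (hf : IsSymm f) (hf0 : f 0 = 0)
    (hE : ∀ y : G → ℤ, y ≠ 0 → ∑ u, y u = 0 → ∑ u, y u • u = 0 → minVal f ≤ energy f y)
    (hd : ∑ i, d i = 0) (hd0 : ∀ i, d i ≠ 0) (ht : t.leaves = ({r}ᶜ : Finset (Fin n)).val)
    (hgood : t.IsGood d)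
    (hw : ∀ l ∈ t.orders, IsAdmissible f d (w l) ∧ IsAdapted f d (w l) (r :: l)) :
    IsAdmissible (tilde f) d (meanWeighting t.orders w) := by
  refine ⟨fun i => ?_, fun I hI => ?_⟩
  · rw [vertexFlow_eq_flow, tilde_of_ne f (hd0 i)]
    exact flow_meanWeighting_of_forall_eq t.orders_ne_zero fun l hl => by
      rw [← vertexFlow_eq_flow, (hw l hl).1.1]
  by_cases hsum : ∑ i ∈ I, d i = 0
  · rw [hsum, tilde_zero]
    exact minVal_le_flow_meanWeighting hG hf hf0 hE hd ht hgood (fun l hl => (hw l hl).2) hI hsum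
  · rw [tilde_of_ne f hsum]
    exact le_flow_meanWeighting t.orders_ne_zero <| sum_map_nonneg fun l hl =>
      sub_nonneg.2 ((hw l hl).1.2 I hI)

theorem exists_isAdmissible_tilde_of_crossFree (hG : 3 ≤ Fintype.card G) (hf0 : f 0 = 0)
    (hf : IsCyclicallyEffective f)
    (hE : ∀ y : G → ℤ, y ≠ 0 → ∑ u, y u = 0 → ∑ u, y u • u = 0 → minVal f ≤ energy f y)
    (hn : 3 ≤ n) (hd : ∑ i, d i = 0) (hd0 : ∀ i, d i ≠ 0) (hcompl : ∀ I ∈ 𝓣, Iᶜ ∈ 𝓣)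
    (hcross : ∀ I ∈ 𝓣, ∀ J ∈ 𝓣, NestedOrDisjoint I J ∨ I ∪ J = Finset.univ)
    (hsum : ∀ I ∈ 𝓣, ∑ i ∈ I, d i ≠ 0) :
    ∃ w : Weighting n, IsAdmissible (tilde f) d w ∧
      ∀ I ∈ 𝓣, flow w I = tilde f (∑ i ∈ I, d i) := by
  let r : Fin n := ⟨0, by lia⟩
  obtain ⟨t, ht⟩ := (isLaminar_insert_compl_singleton hd (hd0 r) hcross hsum).exists_realizes
    (Set.mem_insert _ _) fun i _ => hd0 i
  choose! w hw using fun l (hl : l ∈ t.orders) =>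
    hf.exists_isAdapted hf0 hn hd (coe_cons_of_mem_orders ht.leaves_eq hl)
  have hflow {I : Finset (Fin n)} (hI : I ∈ 𝓣) (hrI : r ∉ I) :
      flow (meanWeighting t.orders w) I = f (∑ i ∈ I, d i) :=
    flow_meanWeighting_of_mem_blocks (ht.val_mem_blocks I (.inr ⟨hI, hrI⟩) (by simpa))
      fun l hl => (hw l hl).2
  refine ⟨_, isAdmissible_meanWeighting hG hf.1 hf0 hE hd hd0 ht.leaves_eq ht.isGood hw,
    fun I hI => ?_⟩
  rw [tilde_of_ne f (hsum I hI)]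
  by_cases hrI : r ∈ I
  · rw [← flow_compl, hflow (hcompl I hI) (by simpa), sum_compl_eq_neg hd, hf.1]
  · exact hflow hI hrI

end CrossFree

/-! ### Inserting a zero label -/

section InsertZero

variable {n : ℕ} {k : Fin (n + 1)} {p q : Fin n} {c : ℚ} {w : Weighting n}

theorem flow_single {a b : Fin n} (hab : a ≠ b) (I : Finset (Fin n)) :
    flow (Pi.single s(a, b) 1) I = if a ∈ I ↔ b ∈ I then 0 else 1 := by
  have hsingle (i j : Fin n) : (Pi.single s(a, b) 1 : Weighting n) s(i, j) =
      (if i = a then if j = b then 1 else 0 else 0) +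
        if i = b then if j = a then 1 else 0 else 0 := by
    simp only [Pi.single_apply, Sym2.eq_iff]
    grind
  simp only [flow, hsingle, Finset.sum_add_distrib, Finset.sum_ite_irrel, Finset.sum_ite_eq',
    Finset.sum_const_zero, Finset.mem_compl]
  grind

theorem map_succAboveEmb_univ (k : Fin (n + 1)) :
    Finset.univ.map k.succAboveEmb = {k}ᶜ := by
  rw [Finset.map_eq_image, Fin.coe_succAboveEmb, Fin.image_succAbove_univ]

theorem notMem_map_succAboveEmb (k : Fin (n + 1)) (I : Finset (Fin n)) :
    k ∉ I.map k.succAboveEmb := by simp [Fin.succAbove_ne]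

theorem compl_map_succAboveEmb (k : Fin (n + 1)) (I : Finset (Fin n)) :
    (I.map k.succAboveEmb)ᶜ = insert k (Iᶜ.map k.succAboveEmb) := by
  ext x
  rcases Fin.eq_self_or_eq_succAbove k x with rfl | ⟨j, rfl⟩ <;> simp [Fin.succAbove_ne]

theorem exists_eq_map_succAboveEmb {I : Finset (Fin (n + 1))} (hk : k ∉ I) :
    ∃ J : Finset (Fin n), I = J.map k.succAboveEmb := by
  have hI : I ⊆ Finset.univ.map k.succAboveEmb := by rw [map_succAboveEmb_univ]; simpa
  obtain ⟨J, -, hJ⟩ := Finset.subset_map_iff.1 hI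
  exact ⟨J, hJ⟩

/-- The weighting of the complete graph on `[n + 1]` that agrees with `w` away from the vertex `k`
and is zero on the edges at `k`. -/
noncomputable def extendWeighting (k : Fin (n + 1)) (w : Weighting n) : Weighting (n + 1) :=
  Function.extend (Sym2.map k.succAbove) w 0

theorem flow_extendWeighting (k : Fin (n + 1)) (w : Weighting n) (I : Finset (Fin n)) :
    flow (extendWeighting k w) (I.map k.succAboveEmb) = flow w I := by
  have hinj : Function.Injective (Sym2.map k.succAbove) :=
    Sym2.map.injective Fin.succAbove_right_injective
  have hzero (i : Fin n) : extendWeighting k w s(k.succAbove i, k) = 0 := by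
    refine Function.extend_apply' _ _ _ fun ⟨e, he⟩ => ?_
    obtain ⟨x, -, hx⟩ := Sym2.mem_map.1 (he ▸ Sym2.mem_mk_right (k.succAbove i) k)
    exact Fin.succAbove_ne k x hx
  have hsucc (i j : Fin n) : extendWeighting k w s(k.succAbove i, k.succAbove j) = w s(i, j) :=
    hinj.extend_apply w 0 s(i, j)
  simp only [flow, compl_map_succAboveEmb, Finset.sum_map,
    Finset.sum_insert (notMem_map_succAboveEmb k Iᶜ), Fin.coe_succAboveEmb, hzero, hsucc, zero_add]

/-- The weighting obtained from `w` by inserting a new vertex `k` into the edge `p ∼ q`: a weight of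
`c / 2` is moved from that edge to the path `p ∼ k ∼ q`, so that the flow through `k` is `c`. -/
noncomputable def subdivideEdge (k : Fin (n + 1)) (p q : Fin n) (c : ℚ) (w : Weighting n) :
    Weighting (n + 1) :=
  extendWeighting k w + (c / 2) • (Pi.single s(k, k.succAbove p) 1 +
    Pi.single s(k, k.succAbove q) 1 + (-1 : ℚ) • Pi.single s(k.succAbove p, k.succAbove q) 1)

theorem flow_subdivideEdge (hpq : p ≠ q) (k : Fin (n + 1)) (c : ℚ) (w : Weighting n)
    (I : Finset (Fin n)) : flow (subdivideEdge k p q c w) (I.map k.succAboveEmb) =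
      flow w I + if p ∈ I ∧ q ∈ I then c else 0 := by
  have hmem (i : Fin n) : k.succAbove i ∈ I.map k.succAboveEmb ↔ i ∈ I := by simp
  simp only [subdivideEdge, flow_add, flow_smul, flow_extendWeighting,
    flow_single (Fin.succAbove_ne k _).symm, flow_single (Fin.succAbove_right_injective.ne hpq),
    notMem_map_succAboveEmb, hmem]
  grind

theorem vertexFlow_subdivideEdge_self (hpq : p ≠ q) :
    vertexFlow (subdivideEdge k p q c w) k = c := by
  rw [vertexFlow_eq_flow, ← flow_compl, ← map_succAboveEmb_univ, flow_subdivideEdge hpq, flow_univ]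
  simp

theorem vertexFlow_subdivideEdge_succAbove (hpq : p ≠ q) (i : Fin n) :
    vertexFlow (subdivideEdge k p q c w) (k.succAbove i) = vertexFlow w i := by
  have hi : ¬(p ∈ ({i} : Finset (Fin n)) ∧ q ∈ ({i} : Finset (Fin n))) := by
    simp only [Finset.mem_singleton]
    exact fun h => hpq (h.1.trans h.2.symm)
  have := flow_subdivideEdge hpq k c w {i}
  rwa [Finset.map_singleton, Fin.coe_succAboveEmb, if_neg hi, add_zero, ← vertexFlow_eq_flow,
    ← vertexFlow_eq_flow] at this

variable {G : Type*} [AddCommGroup G] {f : G → ℚ}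

theorem IsAdmissible.le_flow (hf : IsSymm f) {d : Fin n → G} (hd : ∑ i, d i = 0)
    (hw : IsAdmissible f d w) {I : Finset (Fin n)} (hI : I.Nonempty) (hI' : Iᶜ.Nonempty) :
    f (∑ i ∈ I, d i) ≤ flow w I := by
  by_cases h₁ : I.card = 1
  · obtain ⟨i, rfl⟩ := Finset.card_eq_one.1 h₁
    rw [← vertexFlow_eq_flow, hw.1, Finset.sum_singleton]
  by_cases h₂ : Iᶜ.card = 1
  · obtain ⟨i, hi⟩ := Finset.card_eq_one.1 h₂
    rw [← flow_compl, ← hf, ← sum_compl_eq_neg hd, hi, ← vertexFlow_eq_flow, hw.1,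
      Finset.sum_singleton]
  have := hI.card_pos
  have := hI'.card_pos
  exact hw.2 I ⟨by lia, by lia⟩

variable {d : Fin (n + 1) → G}

theorem sum_succAbove_eq_zero (hd : ∑ i, d i = 0) (hk : d k = 0) :
    ∑ j, d (k.succAbove j) = 0 := by
  rwa [Fin.sum_univ_succAbove d k, hk, zero_add] at hd

theorem IsAdmissible.le_flow_subdivideEdge (hf : IsSymm f) (hc : 0 ≤ c) (hd : ∑ i, d i = 0)
    (hk : d k = 0) (hpq : p ≠ q) (hw : IsAdmissible f (fun j => d (k.succAbove j)) w)
    {I : Finset (Fin (n + 1))} (hkI : k ∉ I) (hI : IsProper I) :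
    f (∑ i ∈ I, d i) ≤ flow (subdivideEdge k p q c w) I := by
  obtain ⟨J, rfl⟩ := exists_eq_map_succAboveEmb hkI
  obtain ⟨hJ, hJ'⟩ := hI
  rw [compl_map_succAboveEmb, Finset.card_insert_of_notMem (notMem_map_succAboveEmb k Jᶜ)] at hJ'
  rw [Finset.card_map] at hJ hJ'
  have := hw.le_flow hf (sum_succAbove_eq_zero hd hk) (I := J)
    (Finset.card_pos.1 (by lia)) (Finset.card_pos.1 (by lia))
  rw [flow_subdivideEdge hpq, Finset.sum_map]
  refine this.trans (le_add_of_nonneg_right ?_)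
  split_ifs
  exacts [hc, le_rfl]

theorem EffectiveWrt.insert_zero (hf : IsSymm f) (hf0 : 0 ≤ f 0) (hn : 2 ≤ n)
    (hd : ∑ i, d i = 0) (hk : d k = 0) (h : EffectiveWrt f fun j => d (k.succAbove j)) :
    EffectiveWrt f d := by
  obtain ⟨w, hw⟩ := h
  have : Nontrivial (Fin n) := Fin.nontrivial_iff_two_le.2 hn
  obtain ⟨p, q, hpq⟩ := exists_pair_ne (Fin n)
  refine ⟨subdivideEdge k p q (f 0) w, fun i => ?_, fun I hI => ?_⟩
  · rcases Fin.eq_self_or_eq_succAbove k i with rfl | ⟨j, rfl⟩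
    · rw [vertexFlow_subdivideEdge_self hpq, hk]
    · rw [vertexFlow_subdivideEdge_succAbove hpq, hw.1]
  by_cases hkI : k ∈ I
  · rw [← hf, ← sum_compl_eq_neg hd, ← flow_compl]
    exact hw.le_flow_subdivideEdge hf hf0 hd hk hpq (by simpa) ⟨hI.2, by simpa using hI.1⟩
  · exact hw.le_flow_subdivideEdge hf hf0 hd hk hpq hkI hI

theorem effectiveWrt_two (hf : IsSymm f) {d : Fin 2 → G} (hd : ∑ i, d i = 0) :
    EffectiveWrt f d := by
  refine ⟨fun _ => f (d 0), fun i => ?_, fun I ⟨hI, hI'⟩ => ?_⟩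
  · have hd1 : f (d 1) = f (d 0) := by
      rw [Fin.sum_univ_two] at hd
      rw [eq_neg_of_add_eq_zero_right hd, hf]
    fin_cases i <;> simp [vertexFlow, hd1]
  · rw [Finset.card_compl, Fintype.card_fin] at hI'
    lia

theorem effectiveWrt_tilde [Fintype G] [DecidableEq G] (hG : 3 ≤ Fintype.card G) (hf0 : f 0 = 0)
    (hf : IsCyclicallyEffective f)
    (hE : ∀ y : G → ℤ, y ≠ 0 → ∑ u, y u = 0 → ∑ u, y u • u = 0 → minVal f ≤ energy f y)
    (hn : 2 ≤ n) {d : Fin n → G} (hd : ∑ i, d i = 0) : EffectiveWrt (tilde f) d := by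
  induction n, hn using Nat.le_induction with
  | base => exact effectiveWrt_two hf.1.tilde hd
  | succ n hn ih =>
    by_cases! h : ∃ k, d k = 0
    · obtain ⟨k, hk⟩ := h
      exact .insert_zero hf.1.tilde (tilde_zero f ▸ minVal_nonneg hf.1 hf0 hE) hn hd hk
        (ih (sum_succAbove_eq_zero hd hk))
    · obtain ⟨w, hw, -⟩ := exists_isAdmissible_tilde_of_crossFree (𝓣 := ∅) hG hf0 hf hE
        (by lia) hd h (by simp) (by simp) (by simp)
      exact ⟨w, hw⟩

end InsertZero

end M0n

theorem mainTheorem7_general {G : Type*} [AddCommGroup G] [Fintype G] [DecidableEq G]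
    (hG : 3 ≤ Fintype.card G) (f : G → ℚ) (hf0 : f 0 = 0) (hcyc : M0n.IsCyclicallyEffective f)
    (hE : ∀ y : G → ℤ, y ≠ 0 → ∑ u, y u = 0 → ∑ u, y u • u = 0 →
      M0n.minVal f ≤ M0n.energy f y) :
    M0n.IsEffective (M0n.tilde f) ∧
    ∀ (n : ℕ), 3 ≤ n → ∀ d : Fin n → G, ∑ i, d i = 0 →
      ∀ (V : Type*) (T : SimpleGraph V) (leaf : Fin n → V), M0n.IsLabeledTree T leaf →
        (∀ I, M0n.IsTreePartition T leaf I → ∑ i ∈ I, d i ≠ 0) →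
          M0n.TreeEffectiveWrt T leaf (M0n.tilde f) d := by
  refine ⟨⟨hcyc.1.tilde, fun n hn d hd => M0n.effectiveWrt_tilde hG hf0 hcyc hE (by lia) hd⟩,
    fun n hn d hd V T leaf hT hsum => ?_⟩
  have hd0 (i : Fin n) : d i ≠ 0 := by simpa using hsum _ (hT.isTreePartition_singleton i)
  exact M0n.exists_isAdmissible_tilde_of_crossFree (𝓣 := {I | M0n.IsTreePartition T leaf I})
    hG hf0 hcyc hE hn hd hd0 (fun I hI => hI.compl hT.isTree)
    (fun I hI J hJ => hI.crossFree hJ hT.isTree) hsum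

theorem mainTheorem7 (m : ℕ) [NeZero m] (hm : 3 ≤ m) (f : ZMod m → ℚ) (hf0 : f 0 = 0)
    (hcyc : M0n.IsCyclicallyEffective f) (hnef : M0n.IsFNef f)
    (hQ : ∀ x : ZMod m → ℤ, x ≠ 0 → ∑ i, x i = 0 →
      M0n.minVal f ≤ M0n.quadForm f (fun i => (x i : ℚ))) :
    M0n.IsEffective (M0n.tilde f) ∧
    ∀ (n : ℕ), 3 ≤ n → ∀ d : Fin n → ZMod m, ∑ i, d i = 0 →
      ∀ (V : Type*) (T : SimpleGraph V) (leaf : Fin n → V), M0n.IsLabeledTree T leaf →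
        (∀ I, M0n.IsTreePartition T leaf I → ∑ i ∈ I, d i ≠ 0) →
          M0n.TreeEffectiveWrt T leaf (M0n.tilde f) d :=
  mainTheorem7_general (by rwa [ZMod.card]) f hf0 hcyc fun _ => M0n.le_energy_of_le_quadForm hQ
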